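/- Let $q\in\mathbb{C}^{\times}$ be not a root of unity and put $\theta=q-q^{-1}$. Let $\mathbb{V}$ be the braided vector space with basis $x_1,x_2$ and braiding $c(x_i\otimes x_j)=q_{ij}\,x_j\otimes x_i$, where $(q_{ij})=\begin{pmatrix} q&q^{-1}\\ q^{-1}&-q\end{pmatrix}$, and let $B(\mathbb{V})$ be its Nichols algebra, a quotient of the tensor algebra $T(\mathbb{V})$. Let $\chi$ be the bicharacter on $\mathbb{Z}^2$ with $\chi(\alpha_i,\alpha_j)=q_{ij}$. All brackets are braided brackets: $[u,v]=uv-\chi(\deg u,\deg v)\,vu$ for elements $u,v$ that are homogeneous for the $\mathbb{N}_0^2$-grading with $\deg x_i=\alpha_i$, extended bilinearly. Order words in $x_1<x_2$ lexicographically. For a Lyndon word $w$ the super-letter $[w]$ is defined by $[x_i]=x_i$ and $[w]=[[u],[v]]$, where $w=uv$ is the decomposition into two Lyndon words with $u$ of minimal length. For $n\ge 1$ let $X_n$ and $Y_n$ be the super-letters of the Lyndon words $x_1(x_1x_2)^{n-1}$ and $(x_1x_2)^{n-1}x_2$. Put $L_0=L_0'=\theta^{-1}$, $L_n=[X_1,Y_n]$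 for $n\ge1$, $L_1'=L_1$, $L_n'=[X_2,Y_{n-1}]$ for $n\ge 2$, $\tilde L_n=\frac12(L_n+L_n')$ for $n\ge 0$, $\tilde L_n=0$ for $n<0$, $M_3=[L_2,L_1]$ and $M_5=[L_2,[L_2,L_1]]$. Then the following relations hold in $B(\mathbb{V})$ for all $k\ge 0$: (a) $\tilde L_{4k+1}=\frac12\theta L_1\tilde L_{4k}+\frac12\theta\tilde L_{4k}L_1+\frac14[\tilde L_{4k-2},M_3]$; (b) $[\tilde L_{4k},L_1]=\frac12\theta M_3\tilde L_{4k-2}+\frac12\theta\tilde L_{4k-2}M_3+\frac14[\tilde L_{4k-4},M_5]$; (c) $[\tilde L_{4k+2},L_1]=\frac12\theta M_3\tilde L_{4k}+\frac12\theta\tilde L_{4k}M_3+\frac14[\tilde L_{4k-2},M_5]$; (d) $\tilde L_{4k+3}=\frac12\theta L_1\tilde L_{4k+2}+\frac12\theta\tilde L_{4k+2}L_1+\frac14[\tilde L_{4k},M_3]$; (e) $[\tilde L_n,L_1^2]=0=[L_n,L_1^2]$ for every $n\in\{4k,4k+1,4k+2,4k+3\}$, that is, for every $n\ge0$; (f)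 $[\tilde L_2,\tilde L_{4k}]=0$ and $[\tilde L_2,\tilde L_{4k+2}]=0$. -/

import Mathlib

namespace BraidedNichols

noncomputable section

section General

variable {K : Type*} [Field K] {ι : Type*} [Fintype ι] [LinearOrder ι]

/-- The tensor algebra `T(V)` of the vector space `V` with basis `x_i`, `i ∈ ι`, identified with
the linear span of all words in the letters `x_i`; multiplication is concatenation of words. -/
abbrev TensorAlg (K ι : Type*) [Field K] : Type _ := MonoidAlgebra K (FreeMonoid ι)

/-- The element of `T(V)` given by a word. -/
def word (w : List ι) : TensorAlg K ι := MonoidAlgebra.single (FreeMonoid.ofList w) 1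

/-- The multidegree of a word: the letter `x_i` has degree `α_i`. -/
def deg (w : FreeMonoid ι) : ι → ℕ := fun i => w.toList.count i

/-- The bicharacter `χ` with `χ(α_i, α_j) = q_ij`, on the monoid of multidegrees. -/
def chi (Q : Matrix ι ι K) (α β : ι → ℕ) : K := ∏ i, ∏ j, Q i j ^ (α i * β j)

/-- The composition `m ∘ c : T(V) ⊗ T(V) → T(V)` of the multiplication with the braiding, that is
the bilinear map with `u ⊗ v ↦ χ(deg u, deg v) v u` for words `u`, `v`. -/
def mulBraid (Q : Matrix ι ι K) (a b : TensorAlg K ι) : TensorAlg K ι :=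
  a.coeff.sum fun u x => b.coeff.sum fun v y =>
    MonoidAlgebra.single (v * u) (x * y * chi Q (deg u) (deg v))

/-- The braided bracket `[a, b]_c = m ∘ (id - c) (a ⊗ b)`. -/
def bracket (Q : Matrix ι ι K) (a b : TensorAlg K ι) : TensorAlg K ι :=
  a * b - mulBraid Q a b

/-- The quantum symmetrizer `S_n = ∑_{σ ∈ 𝔖_n} T_σ` on a word of length `n`, where `T_σ` is the
Matsumoto lift of `σ` to the braid group, acting through the braiding
`c(x_i ⊗ x_j) = q_ij x_j ⊗ x_i`. It sends the letter in position `a` to position `σ a`, and every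
inversion `a < b`, `σ a > σ b` contributes one factor `q_ij` for the letters in
positions `a` and `b`. -/
def symmetrizeWord (Q : Matrix ι ι K) (w : List ι) : TensorAlg K ι :=
  ∑ σ : Equiv.Perm (Fin w.length),
    (∏ a, ∏ b, if a < b ∧ σ b < σ a then Q (w.get a) (w.get b) else 1) •
      word (List.ofFn fun i => w.get (σ⁻¹ i))

/-- The quantum symmetrizer on `T(V)`; on the component of degree `n` it is `S_n`. -/
def symmetrizer (Q : Matrix ι ι K) (a : TensorAlg K ι) : TensorAlg K ι :=
  a.coeff.sum fun w x => x • symmetrizeWord Q w.toList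

/-- The relations of the Nichols algebra: the elements of `⨁ ker S_n` are set to zero. -/
def NicholsRel (Q : Matrix ι ι K) (a b : TensorAlg K ι) : Prop :=
  symmetrizer Q a = 0 ∧ b = 0

/-- The Nichols algebra `B(V) = T(V) / ⨁ ker S_n` of the braided vector space `V` of diagonal type
with braiding matrix `Q`. (For invertible entries `q_ij`, the space `⨁ ker S_n` is itself a
two-sided ideal, so that passing to the ideal it generates adds nothing.) -/
abbrev NicholsAlgebra (Q : Matrix ι ι K) : Type _ := RingQuot (NicholsRel Q)

/-- The canonical projection `T(V) → B(V)`. -/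
def toNichols (Q : Matrix ι ι K) : TensorAlg K ι →ₐ[K] NicholsAlgebra Q :=
  RingQuot.mkAlgHom K (NicholsRel Q)

/-- A nonempty word is a Lyndon word if it is lexicographically smaller than each of its proper
nonempty suffixes. -/
def IsLyndon (w : List ι) : Prop :=
  w ≠ [] ∧ ∀ u v : List ι, u ≠ [] → v ≠ [] → w = u ++ v → w < v

/-- Cutting `w` after its first `i` letters gives a product of two Lyndon words. -/
def IsLyndonCut (w : List ι) (i : ℕ) : Prop :=
  0 < i ∧ i < w.length ∧ IsLyndon (w.take i) ∧ IsLyndon (w.drop i)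

open Classical in
/-- The super-letter `[w]` of a Lyndon word `w`: `[x_i] = x_i`, and `[w] = [[u], [v]]` where
`w = u v` is the Shirshov decomposition, the decomposition into two Lyndon words with `u` of
minimal length. (Only its values at Lyndon words are meaningful.) -/
def superLetter (Q : Matrix ι ι K) (w : List ι) : TensorAlg K ι :=
  if h : ∃ i, IsLyndonCut w i then
    bracket Q (superLetter Q (w.take (Nat.find h))) (superLetter Q (w.drop (Nat.find h)))
  else word w
termination_by w.length
decreasing_by
  · have := Nat.find_spec h
    rw [List.length_take]
    exact lt_of_le_of_lt (min_le_left _ _) this.2.1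
  · have := Nat.find_spec h
    rw [List.length_drop]
    exact Nat.sub_lt (lt_trans this.1 this.2.1) this.1

end General

section Special

/-- The braiding matrix of the two-dimensional braided vector space `𝕍`. The letters `x_1`, `x_2`
are indexed by `0`, `1 : Fin 2`. -/
def braidingMatrix (q : ℂ) : Matrix (Fin 2) (Fin 2) ℂ := !![q, q⁻¹; q⁻¹, -q]

/-- The tensor algebra `T(𝕍)`. -/
abbrev TV : Type := TensorAlg ℂ (Fin 2)

/-- The canonical projection `T(𝕍) → B(𝕍)`. -/
def toB (q : ℂ) : TV →ₐ[ℂ] NicholsAlgebra (braidingMatrix q) := toNichols (braidingMatrix q)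

/-- The braided bracket of `T(𝕍)`. -/
def br (q : ℂ) (a b : TV) : TV := bracket (braidingMatrix q) a b

/-- `θ = q - q⁻¹`. -/
def theta (q : ℂ) : ℂ := q - q⁻¹

/-- `X_n`, `n ≥ 1`: the super-letter of the Lyndon word `x_1 (x_1 x_2)^(n-1)`. -/
def X (q : ℂ) (n : ℕ) : TV :=
  superLetter (braidingMatrix q) (0 :: (List.replicate (n - 1) [0, 1]).flatten)

/-- `Y_n`, `n ≥ 1`: the super-letter of the Lyndon word `(x_1 x_2)^(n-1) x_2`. -/
def Y (q : ℂ) (n : ℕ) : TV :=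
  superLetter (braidingMatrix q) ((List.replicate (n - 1) [0, 1]).flatten ++ [1])

/-- `L_0 = θ⁻¹` and `L_n = [X_1, Y_n]` for `n ≥ 1`. -/
def L (q : ℂ) : ℕ → TV
  | 0 => algebraMap ℂ TV (theta q)⁻¹
  | n + 1 => br q (X q 1) (Y q (n + 1))

/-- `L'_0 = θ⁻¹`, `L'_1 = L_1`, and `L'_n = [X_2, Y_{n-1}]` for `n ≥ 2`. -/
def L' (q : ℂ) : ℕ → TV
  | 0 => algebraMap ℂ TV (theta q)⁻¹
  | 1 => L q 1
  | n + 2 => br q (X q 2) (Y q (n + 1))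

/-- `L̃_n = (L_n + L'_n) / 2` for `n ≥ 0`, and `L̃_n = 0` for `n < 0`. -/
def Ltilde (q : ℂ) : ℤ → TV
  | Int.ofNat n => (1 / 2 : ℂ) • (L q n + L' q n)
  | Int.negSucc _ => 0

/-- `M_3 = [L_2, L_1]`. -/
def M3 (q : ℂ) : TV := br q (L q 2) (L q 1)

/-- `M_5 = [L_2, [L_2, L_1]]`. -/
def M5 (q : ℂ) : TV := br q (L q 2) (br q (L q 2) (L q 1))

end Special

end

end BraidedNichols

open BraidedNichols

/-! Write `l`, `h` for the images of `L_1`, `L̃_2` in `B(𝕍)`. The bidegrees of `L_n`, `L'_n`, `L̃_n`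
are diagonal, so the brackets in the relations become ordinary commutators, and everything is
governed by `l`, `h` and the element `l²`. Bracketing with `l²` raises the index of the
super-letters by two.

The Serre relations give `[h, x_0]` and `[h, y_0]`, then `[h, x_1]` and `[h, y_1]`, and then `[h,
l²] = 0` (`commute_h_c`). Since `h` commutes with `l²`, the formula for `[h, y_n]` spreads to all
`n`. Applying the derivation `[h, ·]` to the brackets of `x_0`, `x_1` with `y_n` gives
`comm_relations_odd` and `comm_relations_even`, provided that earlier `L_m` commute with `l²`. The
difference of the two odd relations yields (a) and (d), their sum yields (b) and (c), and the sum of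
the even ones yields (f).

It remains to prove (e), that every `L_n` commutes with `l²`, by induction together with (f). For
odd `n` this follows from the formula for `L̃_n`. For even `n` the commutator `[L_n, l²]` is killed
by both skew derivations and the augmentation (`commute_L_even`), and in a Nichols algebra such an
element vanishes. This last fact comes from the recursion `symmetrizerₗ_eq` for the quantum
symmetrizer. Finally, the recursions for the super-letters and the computation of bidegrees identify
`T(𝕍)` brackets with these commutators. -/

/-- Two elements of an algebra satisfying the quantum Serre relations of `𝕍`. -/
structure SerrePair (q : ℂ) (A : Type*) [Ring A] [Algebra ℂ A] where
  x₁ : A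
  x₂ : A
  l : A
  l_def : l = x₁ * x₂ - q⁻¹ • (x₂ * x₁)
  serre₁ : x₁ * (x₁ * l - l * x₁) = q • ((x₁ * l - l * x₁) * x₁)
  serre₂ : (l * x₂ + x₂ * l) * x₂ = q • (x₂ * (l * x₂ + x₂ * l))

/-! ### Consequences of the Serre relations: brackets of `x_m`, `y_n` and the action of `h`. -/

namespace SerrePair

variable {q : ℂ} {A : Type*} [Ring A] [Algebra ℂ A] (S : SerrePair q A)

/-- The elements `x_n`, the images of the super-letters `X_{n+1}`. -/
def x : ℕ → A
  | 0 => S.x₁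
  | n + 1 => x n * S.l - (-1 : ℂ) ^ n • (S.l * x n)

/-- The elements `y_n`, the images of the super-letters `Y_{n+1}`. -/
def y : ℕ → A
  | 0 => S.x₂
  | n + 1 => S.l * y n + (-1 : ℂ) ^ n • (y n * S.l)

/-- The braided bracket of `x_m` and `y_n`. -/
noncomputable def w (m n : ℕ) : A :=
  S.x m * S.y n - ((-1 : ℂ) ^ (m * (n + 1)) * q⁻¹) • (S.y n * S.x m)

theorem l_eq_w : S.l = S.w 0 0 := by
  simp [w, x, y, S.l_def]

theorem x_mul_l (n : ℕ) : S.x n * S.l = S.x (n + 1) + (-1 : ℂ) ^ n • (S.l * S.x n) := by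
  simp [x]

theorem l_mul_y (n : ℕ) : S.l * S.y n = S.y (n + 1) - (-1 : ℂ) ^ n • (S.y n * S.l) := by
  simp [y]

theorem x_mul_y (m n : ℕ) : S.x m * S.y n
    = S.w m n + ((-1 : ℂ) ^ (m * (n + 1)) * q⁻¹) • (S.y n * S.x m) := by
  simp [w]

/-- A braided Jacobi identity: in `x_m l y_n` the middle factor can be absorbed to the right, giving
`y_{n+1}`, or to the left, giving `x_{m+1}`. -/
theorem w_shift (m n : ℕ) : S.w m (n + 1) - S.w (m + 1) n
    = (-1 : ℂ) ^ m • (S.l * S.w m n + (-1 : ℂ) ^ (m + n) • (S.w m n * S.l)) := by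
  rcases neg_one_pow_eq_or ℂ m with hm | hm <;> rcases neg_one_pow_eq_or ℂ n with hn | hn <;>
  · simp only [w, x, y, mul_add, add_mul, mul_sub, sub_mul, smul_mul_assoc, mul_smul_comm,
      mul_assoc, smul_add, smul_sub, pow_add, pow_mul, pow_one, one_pow, mul_neg, neg_mul, neg_neg,
      mul_one, one_mul, hm, hn]
    module

/-- The sign in the bracket with `l` alternates with `n`, so two successive brackets with `l` make
one ordinary commutator with `l²`. -/
theorem x_comm_c (n : ℕ) : S.x n * (S.l * S.l) - S.l * S.l * S.x n = S.x (n + 2) := by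
  simp only [x, mul_sub, sub_mul, smul_mul_assoc, mul_smul_comm, mul_assoc, smul_sub, pow_succ]
  rcases neg_one_pow_eq_or ℂ n with hn | hn <;>
  · simp only [hn]
    module

theorem c_comm_y (n : ℕ) : S.l * S.l * S.y n - S.y n * (S.l * S.l) = S.y (n + 2) := by
  simp only [y, mul_add, add_mul, smul_mul_assoc, mul_smul_comm, mul_assoc, smul_add, pow_succ]
  rcases neg_one_pow_eq_or ℂ n with hn | hn <;>
  · simp only [hn]
    module

theorem w_add_two (m n : ℕ) : S.w (m + 2) n
    = S.w m (n + 2) + (S.w m n * (S.l * S.l) - S.l * S.l * S.w m n) := by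
  rcases neg_one_pow_eq_or ℂ m with hm | hm <;>
  · simp only [w, ← S.x_comm_c, ← S.c_comm_y, mul_sub, sub_mul, smul_mul_assoc, mul_smul_comm,
      mul_assoc, smul_sub, pow_add, pow_mul, pow_one, one_pow, mul_neg, neg_mul, mul_one,
      one_mul, even_two, Even.neg_pow, hm]
    module

theorem x_zero_mul_x_one : S.x 0 * S.x 1 = q • (S.x 1 * S.x 0) := by
  simpa [x] using S.serre₁

theorem y_one_mul_y_zero : S.y 1 * S.y 0 = q • (S.y 0 * S.y 1) := by
  simpa [y] using S.serre₂

/-- By the first Serre relation `x_0` passes `x_1` up to the factor `q`; what is left is the bracket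
of `x_0` with `y_n`. -/
theorem x_zero_comm_w_one (hq : q ≠ 0) (n : ℕ) : S.x 0 * S.w 1 n - S.w 1 n * S.x 0
    = q • (S.x 1 * S.w 0 n) + ((-1 : ℂ) ^ n * q⁻¹) • (S.w 0 n * S.x 1) := by
  have h := S.x_zero_mul_x_one
  have h1 : S.x 0 * (S.x 1 * S.y n) = q • (S.x 1 * (S.x 0 * S.y n)) := by
    rw [← mul_assoc, h, smul_mul_assoc, mul_assoc]
  rcases neg_one_pow_eq_or ℂ n with hn | hn <;>
  · simp only [w, mul_sub, sub_mul, smul_mul_assoc, mul_smul_comm, mul_assoc, smul_sub, h, h1,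
      pow_add, pow_one, pow_zero, zero_mul, mul_neg, neg_mul, neg_neg, mul_one, one_mul, hn]
    match_scalars <;> field_simp

theorem w_one_comm_y_zero (hq : q ≠ 0) (m : ℕ) :
    S.w m 1 * S.y 0 - (-1 : ℂ) ^ m • (S.y 0 * S.w m 1)
    = q • (S.w m 0 * S.y 1) - q⁻¹ • (S.y 1 * S.w m 0) := by
  have h := S.y_one_mul_y_zero
  have h1 : S.y 1 * (S.y 0 * S.x m) = q • (S.y 0 * (S.y 1 * S.x m)) := by
    rw [← mul_assoc, h, smul_mul_assoc, mul_assoc]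
  rcases neg_one_pow_eq_or ℂ m with hm | hm <;>
  · simp only [w, mul_sub, sub_mul, smul_mul_assoc, mul_smul_comm, mul_assoc, smul_sub, h, h1,
      pow_add, pow_mul, pow_one, zero_add, mul_neg, neg_mul, neg_neg, mul_one, one_mul, hm]
    match_scalars <;> field_simp

/-- The mean of `w_{0,1}` and `w_{1,0}`; it is also `t_2`. -/
noncomputable def h : A := (1 / 2 : ℂ) • (S.w 0 1 + S.w 1 0)

theorem w_zero_one_eq : S.w 0 1 = S.h + S.l * S.l := by
  have e := S.w_shift 0 0
  simp only [← l_eq_w, pow_zero, one_smul, zero_add] at e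
  rw [h]
  linear_combination (norm := module) (1 / 2 : ℂ) • e

theorem w_one_zero_eq : S.w 1 0 = S.h - S.l * S.l := by
  have e := S.w_shift 0 0
  simp only [← l_eq_w, pow_zero, one_smul, zero_add] at e
  rw [h]
  linear_combination (norm := module) (-1 / 2 : ℂ) • e

/-- This is `x_zero_comm_w_one` for `n = 0`, where `w_{1,0} = h - l²` and `w_{0,0} = l`. -/
theorem x_zero_comm_h (hq : q ≠ 0) : S.x 0 * S.h - S.h * S.x 0
    = (q + 1) • S.x 2 - (q - q⁻¹) • (S.l * S.x 1) := by
  have e := S.x_zero_comm_w_one hq 0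
  have e1 := S.x_comm_c 0
  have e2 := S.x_mul_l 1
  rw [w_one_zero_eq, ← l_eq_w] at e
  linear_combination (norm := skip) e + e1 + q • e2
  simp only [mul_sub, sub_mul, pow_zero, pow_one]
  module

theorem h_comm_y_zero (hq : q ≠ 0) : S.h * S.y 0 - S.y 0 * S.h
    = (q - 1) • S.y 2 + (q - q⁻¹) • (S.y 1 * S.l) := by
  have e := S.w_one_comm_y_zero hq 0
  have e1 := S.c_comm_y 0
  have e2 := S.l_mul_y 1
  rw [w_zero_one_eq, ← l_eq_w] at e
  linear_combination (norm := skip) e - e1 + q • e2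
  simp only [mul_add, add_mul, pow_zero, pow_one]
  module

/-- The derivation `[h, ·]` is applied to both factors of `w_{0,n}`. The coefficient `η` stays free
because `[h, y_n]` is at first known only for small `n`, and these cases are used to obtain the
others. -/
theorem h_comm_w_zero (hq : q ≠ 0) {n : ℕ} {η : ℂ} (hy : S.h * S.y n - S.y n * S.h
      = η • S.y (n + 2) + ((-1 : ℂ) ^ n * (q - q⁻¹)) • (S.y (n + 1) * S.l)) :
    S.h * S.w 0 n - S.w 0 n * S.h = -(q + 1) • S.w 2 n + η • S.w 0 (n + 2)
      + (q - q⁻¹) • (S.l * S.w 1 n + (-1 : ℂ) ^ n • (S.w 0 (n + 1) * S.l)) := by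
  have hx := S.x_zero_comm_h hq
  linear_combination (norm := skip) -hx * S.y n + S.x 0 * hy
    + q⁻¹ • (S.y n * hx) - q⁻¹ • (hy * S.x 0)
  rcases neg_one_pow_eq_or ℂ n with hn | hn <;>
  · simp only [w, x, y, mul_add, add_mul, mul_sub, sub_mul, smul_mul_assoc, mul_smul_comm,
      mul_assoc, smul_add, smul_sub, pow_add, pow_mul, pow_one, pow_zero, mul_neg, neg_mul,
      neg_neg, mul_one, one_mul, zero_mul, neg_add, hn]
    module

theorem h_comm_w_one {n : ℕ} {η : ℂ} (hy : S.h * S.y n - S.y n * S.h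
      = η • S.y (n + 2) + ((-1 : ℂ) ^ n * (q - q⁻¹)) • (S.y (n + 1) * S.l))
    (hx : S.x 1 * S.h - S.h * S.x 1 = (q - 1) • S.x 3 + (q - q⁻¹) • (S.l * S.x 2)) :
    S.h * S.w 1 n - S.w 1 n * S.h = -(q - 1) • S.w 3 n + η • S.w 1 (n + 2)
      - (q - q⁻¹) • (S.l * S.w 2 n - (-1 : ℂ) ^ n • (S.w 1 (n + 1) * S.l)) := by
  linear_combination (norm := skip) -hx * S.y n + S.x 1 * hy
    + ((-1 : ℂ) ^ (n + 1) * q⁻¹) • (S.y n * hx) - ((-1 : ℂ) ^ (n + 1) * q⁻¹) • (hy * S.x 1)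
  have h3 : (-1 : ℂ) ^ 3 = -1 := by norm_num
  rcases neg_one_pow_eq_or ℂ n with hn | hn <;>
  · simp only [w, x, y, mul_add, add_mul, mul_sub, sub_mul, smul_mul_assoc, mul_smul_comm,
      mul_assoc, smul_add, smul_sub, pow_add, pow_mul, pow_one, pow_zero, mul_neg, neg_mul,
      neg_neg, mul_one, one_mul, neg_sub, h3, hn]
    module

/-- Computing `[h, l] = [h, w_{0,0}]` with `h_comm_w_zero` produces `w_{2,0}` and `w_{0,2}`. They
agree because `l` commutes with `l²`, and their joint coefficient is `-(q + 1) + (q - 1) = -2`. -/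
theorem w_zero_two_eq (hq : q ≠ 0) : S.w 0 2
    = (1 / 2 : ℂ) • ((q - q⁻¹) • (S.l * S.h + S.h * S.l) - (S.h * S.l - S.l * S.h)) := by
  have e := S.h_comm_w_zero hq (n := 0) (η := q - 1) (by
    simpa only [pow_zero, one_mul] using S.h_comm_y_zero hq)
  have e1 := S.w_shift 0 1
  have e2 := S.w_add_two 0 0
  simp only [← l_eq_w, zero_add, pow_zero, pow_one, one_smul, mul_assoc, sub_self, add_zero] at e e1 e2
  rw [e2, w_zero_one_eq, w_one_zero_eq] at e
  linear_combination (norm := skip) (1 / 2 : ℂ) • e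
  simp only [add_mul, mul_sub, mul_assoc]
  module

theorem w_one_one_eq (hq : q ≠ 0) : S.w 1 1
    = (1 / 2 : ℂ) • ((q - q⁻¹) • (S.l * S.h + S.h * S.l) + (S.h * S.l - S.l * S.h)) := by
  have e1 := S.w_shift 0 1
  rw [w_zero_two_eq S hq, w_zero_one_eq] at e1
  linear_combination (norm := skip) -e1
  simp only [mul_add, add_mul, mul_assoc, pow_zero, pow_one, zero_add]
  module

/-- With `w_{1,1}` and `w_{1,0}` expressed by `h` and `l`, the known bracket of `w_{1,1}` with `y_0`
becomes, modulo the formula for `[h, y_0]`, the claim times `q + q⁻¹ - 1`. -/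
theorem h_comm_y_one (hq : q ≠ 0) (hκ : q + q⁻¹ - 1 ≠ 0) : S.h * S.y 1 - S.y 1 * S.h
    = (q + 1) • S.y 3 - (q - q⁻¹) • (S.y 2 * S.l) := by
  have e := S.w_one_comm_y_zero hq 1
  have f := S.h_comm_y_zero hq
  rw [w_one_one_eq S hq, w_one_zero_eq] at e
  refine smul_right_injective A hκ ?_
  linear_combination (norm := skip) (-2 : ℂ) • e + (q - q⁻¹ - 1) • (S.l * f)
    - (q - q⁻¹ + 1) • (f * S.l)
  simp only [y, mul_add, add_mul, mul_sub, sub_mul, smul_mul_assoc, mul_smul_comm,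
    mul_assoc, smul_add, smul_sub, pow_one, pow_zero]
  match_scalars <;> field_simp <;> ring

theorem x_one_comm_h (hq : q ≠ 0) (hκ : q + q⁻¹ + 1 ≠ 0) : S.x 1 * S.h - S.h * S.x 1
    = (q - 1) • S.x 3 + (q - q⁻¹) • (S.l * S.x 2) := by
  have e := S.x_zero_comm_w_one hq 1
  have f := S.x_zero_comm_h hq
  rw [w_one_one_eq S hq, w_zero_one_eq] at e
  refine smul_right_injective A hκ ?_
  linear_combination (norm := skip) (-2 : ℂ) • e + (q - q⁻¹ - 1) • (S.l * f)
    + (q - q⁻¹ + 1) • (f * S.l)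
  simp only [x, mul_add, add_mul, mul_sub, sub_mul, smul_mul_assoc, mul_smul_comm,
    mul_assoc, smul_add, smul_sub, pow_one, pow_zero]
  match_scalars <;> field_simp <;> ring

/-- As `w_{0,1} = h + l²`, the commutator `[h, w_{0,1}]` equals `[h, l²]`. Its other evaluation by
`h_comm_w_zero` is again expressed by `h` and `l`, and the comparison leaves a nonzero multiple of
`[h, l²]`. -/
theorem commute_h_c (hq : q ≠ 0) (hκ : q + q⁻¹ - 1 ≠ 0) (hκ' : q + q⁻¹ + 1 ≠ 0)
    (hκ'' : q ^ 2 + 1 ≠ 0) : Commute S.h (S.l * S.l) := by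
  have e := S.h_comm_w_zero hq (n := 1) (η := q + 1) (by
    simpa only [pow_one, neg_one_mul, neg_smul, ← sub_eq_add_neg] using S.h_comm_y_one hq hκ)
  have e2 := S.w_add_two 0 1
  simp only [zero_add] at e e2
  rw [e2, w_zero_one_eq, w_one_one_eq S hq, w_zero_two_eq S hq] at e
  rw [← sub_eq_zero] at e
  refine sub_eq_zero.1 ((smul_eq_zero_iff_right
    (mul_ne_zero hκ'' hκ')).1 ?_ : S.h * (S.l * S.l) - S.l * S.l * S.h = 0)
  linear_combination (norm := skip) (2 * q) • e
  simp only [mul_add, add_mul, mul_sub, sub_mul, smul_mul_assoc, mul_smul_comm,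
    mul_assoc, smul_add, smul_sub, pow_one]
  match_scalars <;> field_simp <;> ring

/-- Bracketing with `l²` commutes with `[h, ·]` and takes the formula for `n` to the one for `n +
2`. -/
theorem h_comm_y (hq : q ≠ 0) (hκ : q + q⁻¹ - 1 ≠ 0) (hc : Commute S.h (S.l * S.l)) (n : ℕ) :
    S.h * S.y n - S.y n * S.h = (q - (-1) ^ n) • S.y (n + 2)
      + ((-1 : ℂ) ^ n * (q - q⁻¹)) • (S.y (n + 1) * S.l) := by
  induction n using Nat.twoStepInduction with
  | zero => simpa using S.h_comm_y_zero hq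
  | one =>
    rw [S.h_comm_y_one hq hκ]
    module
  | more n ih _ =>
    have hc' : S.h * (S.l * S.l) = S.l * S.l * S.h := hc
    rw [← S.c_comm_y n, ← S.c_comm_y (n + 2), show n + 2 + 1 = n + 1 + 2 from rfl,
      ← S.c_comm_y (n + 1)]
    linear_combination (norm := skip) S.l * S.l * ih - ih * (S.l * S.l) + hc' * S.y n - S.y n * hc'
    simp only [mul_add, add_mul, mul_sub, sub_mul, smul_mul_assoc, mul_smul_comm,
      mul_assoc, smul_sub, pow_add, even_two, Even.neg_pow, one_pow, mul_one]
    module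

end SerrePair

theorem comm_of_commute {R : Type*} [Ring R] {a b : R} (hb : Commute b (a * a)) :
    a * (a * b + b * a) = (a * b + b * a) * a := by
  have h1 := hb.eq
  linear_combination (norm := noncomm_ring) -h1

/-! ### The sequences `L`, `L'`, `t` and their commutators with `h` and `l`. -/

namespace SerrePair
variable {q : ℂ} {A : Type*} [Ring A] [Algebra ℂ A] (S : SerrePair q A)

/-- The sequence with `L_0 = (q - q⁻¹)⁻¹` and `L_{n+1} = w_{0,n}`. -/
noncomputable def L : ℕ → A
  | 0 => algebraMap ℂ A (q - q⁻¹)⁻¹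
  | n + 1 => S.w 0 n

/-- The companion of `L` with `L'_1 = w_{0,0}` and `L'_{n+2} = w_{1,n}`. -/
noncomputable def L' : ℕ → A
  | 0 => algebraMap ℂ A (q - q⁻¹)⁻¹
  | 1 => S.w 0 0
  | n + 2 => S.w 1 n

/-- The mean of `L_n` and `L'_n`. -/
noncomputable def t (n : ℕ) : A := (1 / 2 : ℂ) • (S.L n + S.L' n)

theorem t_two : S.t 2 = S.h := rfl

theorem t_one : S.t 1 = S.l := by
  change (1 / 2 : ℂ) • (S.w 0 0 + S.w 0 0) = S.l
  rw [← l_eq_w]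
  module

theorem t_zero : S.t 0 = algebraMap ℂ A (q - q⁻¹)⁻¹ := by
  change (1 / 2 : ℂ) • (algebraMap ℂ A (q - q⁻¹)⁻¹ + algebraMap ℂ A (q - q⁻¹)⁻¹) = _
  module

theorem L_sub_L' (n : ℕ) : S.L (n + 1) - S.L' (n + 1)
    = S.l * S.L n - (-1 : ℂ) ^ n • (S.L n * S.l) := by
  cases n with
  | zero => simp [L, L', Algebra.commutes]
  | succ n =>
    have e := S.w_shift 0 n
    simp only [pow_zero, one_smul, zero_add] at e
    simp only [L, L', e, pow_succ]
    module

variable {S}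

theorem commute_c_L' {n : ℕ} (hL : ∀ m ≤ n, Commute (S.L m) (S.l * S.l)) :
    Commute (S.L' n) (S.l * S.l) := by
  cases n with
  | zero => exact Algebra.commutes _ _
  | succ n =>
    have hl : Commute S.l (S.l * S.l) := (Commute.refl _).mul_right (Commute.refl _)
    have hn := hL n n.le_succ
    rw [show S.L' (n + 1) = S.L (n + 1) - (S.l * S.L n - (-1 : ℂ) ^ n • (S.L n * S.l)) by
      rw [← L_sub_L']; abel]
    exact (hL _ le_rfl).sub_left ((hl.mul_left hn).sub_left ((hn.mul_left hl).smul_left _))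

/-- The formulas for `[h, w_{0,n}]` and `[h, w_{1,n}]` contain `w_{2,n}` and `w_{3,n}`; commutation
with `l²` lets `w_add_two` move these back to first index `0` and `1`. -/
theorem comm_relations_odd (hq : q ≠ 0) (hκ : q + q⁻¹ - 1 ≠ 0) (hκ' : q + q⁻¹ + 1 ≠ 0)
    (hc : Commute S.h (S.l * S.l)) (j : ℕ)
    (hL : ∀ m ≤ 2 * j + 3, Commute (S.L m) (S.l * S.l)) :
    S.h * S.L (2 * j + 3) - S.L (2 * j + 3) * S.h = (-2 : ℂ) • S.L (2 * j + 5)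
      + (q - q⁻¹) • (S.l * S.L' (2 * j + 4) + S.L (2 * j + 4) * S.l) ∧
    S.h * S.L' (2 * j + 3) - S.L' (2 * j + 3) * S.h = (2 : ℂ) • S.L' (2 * j + 5)
      - (q - q⁻¹) • (S.l * S.L (2 * j + 4) + S.L' (2 * j + 4) * S.l) := by
  have e1 := S.h_comm_w_zero hq (S.h_comm_y hq hκ hc (2 * j + 2))
  have e2 := S.h_comm_w_one (S.h_comm_y hq hκ hc (2 * j + 1)) (S.x_one_comm_h hq hκ')
  have a1 := S.w_add_two 0 (2 * j + 2)
  have a2 := S.w_add_two 1 (2 * j + 1)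
  have a3 := S.w_add_two 0 (2 * j + 1)
  have c1 := (hL (2 * j + 3) le_rfl).eq
  have c2 := (commute_c_L' hL).eq
  have c3 := (hL (2 * j + 2) (Nat.le_succ _)).eq
  have p1 : (-1 : ℂ) ^ (2 * j + 2) = 1 := by simp [pow_add, pow_mul]
  have p2 : (-1 : ℂ) ^ (2 * j + 1) = -1 := by simp [pow_add, pow_mul]
  simp only [p1, p2, L, L', zero_add, Nat.add_assoc, Nat.reduceAdd] at *
  rw [a1, sub_eq_zero.2 c1] at e1
  rw [a2, a3, sub_eq_zero.2 c2, sub_eq_zero.2 c3] at e2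
  constructor
  · rw [e1]; module
  · rw [e2, add_zero, add_zero]; module

theorem comm_relations_even (hq : q ≠ 0) (hκ : q + q⁻¹ - 1 ≠ 0) (hκ' : q + q⁻¹ + 1 ≠ 0)
    (hc : Commute S.h (S.l * S.l)) (j : ℕ)
    (hL : Commute (S.L (2 * j + 1)) (S.l * S.l)) :
    S.h * S.L (2 * j + 2) - S.L (2 * j + 2) * S.h =
      (-(q + 1)) • (S.L (2 * j + 2) * (S.l * S.l) - S.l * S.l * S.L (2 * j + 2))
      + (q - q⁻¹) • (S.l * S.L' (2 * j + 3) - S.L (2 * j + 3) * S.l) ∧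
    S.h * S.L' (2 * j + 2) - S.L' (2 * j + 2) * S.h =
      (-(q - 1)) • (S.L' (2 * j + 2) * (S.l * S.l) - S.l * S.l * S.L' (2 * j + 2))
      - (q - q⁻¹) • (S.l * S.L (2 * j + 3) - S.L' (2 * j + 3) * S.l) := by
  have e1 := S.h_comm_w_zero hq (S.h_comm_y hq hκ hc (2 * j + 1))
  have e2 := S.h_comm_w_one (S.h_comm_y hq hκ hc (2 * j)) (S.x_one_comm_h hq hκ')
  have a1 := S.w_add_two 0 (2 * j + 1)
  have a2 := S.w_add_two 1 (2 * j)
  have a3 := S.w_add_two 0 (2 * j)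
  have c3 := hL.eq
  have p1 : (-1 : ℂ) ^ (2 * j) = 1 := by simp [pow_mul]
  have p2 : (-1 : ℂ) ^ (2 * j + 1) = -1 := by simp [pow_add, pow_mul]
  simp only [p1, p2, L, L', zero_add, Nat.add_assoc, Nat.reduceAdd] at *
  rw [a1] at e1
  rw [a2, a3, sub_eq_zero.2 c3] at e2
  constructor
  · rw [e1]; module
  · rw [e2, add_zero]; module

/-- This identity is what makes the second skew derivative of `[L_{2j+4}, l²]` vanish. It arises by
applying `[h, ·]` to the formula for `[x_0, L'_{2j+3}]` and eliminating `L'_{2j+5}` with the same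
formula two steps later. -/
theorem x_one_comm_L (hq : q ≠ 0) (hκ : q + q⁻¹ - 1 ≠ 0) (hκ' : q + q⁻¹ + 1 ≠ 0)
    (hκ'' : q ^ 2 + 1 ≠ 0) (hc : Commute S.h (S.l * S.l)) (j : ℕ)
    (hL : ∀ m ≤ 2 * j + 3, Commute (S.L m) (S.l * S.l)) :
    S.x 1 * S.L (2 * j + 4) - S.L (2 * j + 4) * S.x 1
      = q • (S.x 2 * S.L' (2 * j + 3)) - q⁻¹ • (S.L' (2 * j + 3) * S.x 2) := by
  have p1 : (-1 : ℂ) ^ (2 * j + 2) = 1 := by simp [pow_add, pow_mul]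
  have p2 : (-1 : ℂ) ^ (2 * j + 1) = -1 := by simp [pow_add, pow_mul]
  have p3 : (-1 : ℂ) ^ (2 * j + 3) = -1 := by simp [pow_mul, pow_succ]
  have r1 := S.x_zero_comm_w_one hq (2 * j + 1)
  have r1' := S.x_zero_comm_w_one hq (2 * j + 3)
  have r1'' := S.x_zero_comm_w_one hq (2 * j + 2)
  have hx0 := S.x_zero_comm_h hq
  have hx1 := S.x_one_comm_h hq hκ'
  have rel2 := (comm_relations_odd hq hκ hκ' hc j hL).2
  have rel1 := (comm_relations_even hq hκ hκ' hc j (hL _ (by omega))).1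
  have cJ := (commute_c_L' hL).eq
  have cy := (hL (2 * j + 2) (Nat.le_succ _)).eq
  have s1 := S.L_sub_L' (2 * j + 2)
  have s2 := S.L_sub_L' (2 * j + 3)
  rw [p1, one_smul] at s1
  rw [p3, neg_one_smul, sub_neg_eq_add] at s2
  rw [sub_eq_zero.2 cy, smul_zero, zero_add] at rel1
  change S.x 0 * S.L' (2 * j + 3) - S.L' (2 * j + 3) * S.x 0
    = q • (S.x 1 * S.L (2 * j + 2)) + _ • (S.L (2 * j + 2) * S.x 1) at r1
  change S.x 0 * S.L' (2 * j + 5) - S.L' (2 * j + 5) * S.x 0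
    = q • (S.x 1 * S.L (2 * j + 4)) + _ • (S.L (2 * j + 4) * S.x 1) at r1'
  change S.x 0 * S.L' (2 * j + 4) - S.L' (2 * j + 4) * S.x 0
    = q • (S.x 1 * S.L (2 * j + 3)) + _ • (S.L (2 * j + 3) * S.x 1) at r1''
  have s1' := sub_eq_iff_eq_add.1 s1
  have s2' : S.L' (2 * j + 4) = S.L (2 * j + 4) -
      (S.l * S.L' (2 * j + 3) + S.L' (2 * j + 3) * S.l) := by
    rw [s1'] at s2
    linear_combination (norm := noncomm_ring) -s2 + cy
  rw [p2] at r1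
  rw [p3] at r1'
  rw [p1] at r1''
  simp only [s2', s1'] at r1'' rel2 rel1
  generalize S.L (2 * j + 4) = K at *
  generalize S.L' (2 * j + 3) = J at *
  generalize S.L (2 * j + 2) = y at *
  generalize S.L' (2 * j + 5) = Z at *
  -- The elimination yields the claim only after multiplication by `q + q⁻¹`.
  refine smul_right_injective A (show q + q⁻¹ ≠ 0 from fun h0 => hκ'' ?_) ?_
  · field_simp at h0
    linear_combination h0
  linear_combination (norm := skip) S.h * r1 - r1 * S.h + (q - 1) • (r1 * (S.l * S.l))
    + (q - q⁻¹) • (S.l * r1 * S.l) + (1 - q⁻¹) • (S.l * S.l * r1) + (q - q⁻¹) • (S.l * r1'')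
    + (q - q⁻¹) • (r1'' * S.l) - (2 : ℂ) • r1' + hx0 * J - J * hx0 + q⁻¹ • (y * hx1)
    - q • (hx1 * y) - S.x 0 * rel2 + rel2 * S.x 0 - (q - 1) • (S.x 0 * cJ) + (q - 1) • (cJ * S.x 0)
    - q⁻¹ • (rel1 * S.x 1) + q • (S.x 1 * rel1) - (1 - q⁻¹) • (cy * S.x 1)
    + (q * (q - 1)) • (S.x 1 * cy)
  simp only [x, mul_add, add_mul, mul_sub, sub_mul, smul_mul_assoc, mul_smul_comm,
    mul_assoc, smul_add, smul_sub, pow_one, pow_zero, one_smul]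
  match_scalars <;> field_simp <;> ring

theorem L'_odd (j : ℕ) : S.L' (2 * j + 1)
    = S.L (2 * j + 1) - (S.l * S.L (2 * j) - S.L (2 * j) * S.l) := by
  have e := S.L_sub_L' (2 * j)
  simp only [pow_mul, even_two, Even.neg_pow, one_pow, one_smul] at e
  rw [← e]
  abel

theorem L'_even (j : ℕ) : S.L' (2 * j + 2)
    = S.L (2 * j + 2) - (S.l * S.L (2 * j + 1) + S.L (2 * j + 1) * S.l) := by
  have e := S.L_sub_L' (2 * j + 1)
  simp only [pow_add, pow_mul, pow_one, even_two, Even.neg_pow, one_pow, one_mul, neg_smul,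
    one_smul, sub_neg_eq_add] at e
  rw [← e]
  abel

/-- Add the two odd relations. The terms with `q - q⁻¹` cancel because `L_{2j+4} - L'_{2j+4}` is the
anticommutator of `l` and `L_{2j+3}`, which commutes with `l`. -/
theorem t_even_comm_l (hq : q ≠ 0) (hκ : q + q⁻¹ - 1 ≠ 0) (hκ' : q + q⁻¹ + 1 ≠ 0)
    (hc : Commute S.h (S.l * S.l)) (j : ℕ)
    (hL : ∀ m ≤ 2 * j + 3, Commute (S.L m) (S.l * S.l)) :
    S.t (2 * j + 4) * S.l - S.l * S.t (2 * j + 4)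
      = S.h * S.t (2 * j + 3) - S.t (2 * j + 3) * S.h := by
  obtain ⟨e1, e2⟩ := comm_relations_odd hq hκ hκ' hc j hL
  have s5 : S.L' (2 * j + 5) = _ := L'_odd (j + 2)
  have s4 : S.L' (2 * j + 4) = _ := L'_even (j + 1)
  have k := comm_of_commute (hL (2 * j + 3) le_rfl)
  simp only [t]
  rw [s4] at e1 ⊢
  rw [s4, s5] at e2
  linear_combination (norm := skip) (-1 / 2 : ℂ) • e1 - (1 / 2 : ℂ) • e2
    + ((1 + (q - q⁻¹)) / 2) • k
  simp only [show 2 * (j + 2) = 2 * j + 4 by ring, show 2 * (j + 1) = 2 * j + 2 by ring,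
    Nat.add_assoc, Nat.reduceAdd, mul_add, add_mul, mul_sub, sub_mul, smul_mul_assoc,
    mul_smul_comm, mul_assoc, smul_add, smul_sub]
  module

/-- Subtract the two odd relations. Since `L_{2j+3} - L'_{2j+3} = [l, t_{2j+2}]` and `h` commutes
with `t_{2j+2}`, the left side becomes `[[h, l], t_{2j+2}]`. -/
theorem t_odd_eq (hq : q ≠ 0) (hκ : q + q⁻¹ - 1 ≠ 0) (hκ' : q + q⁻¹ + 1 ≠ 0)
    (hc : Commute S.h (S.l * S.l)) (j : ℕ)
    (hL : ∀ m ≤ 2 * j + 3, Commute (S.L m) (S.l * S.l)) (ht : Commute S.h (S.t (2 * j + 2))) :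
    S.t (2 * j + 5) = (1 / 2 * (q - q⁻¹)) • (S.l * S.t (2 * j + 4))
      + (1 / 2 * (q - q⁻¹)) • (S.t (2 * j + 4) * S.l)
      + (1 / 4 : ℂ) • (S.t (2 * j + 2) * (S.h * S.l - S.l * S.h)
        - (S.h * S.l - S.l * S.h) * S.t (2 * j + 2)) := by
  obtain ⟨e1, e2⟩ := comm_relations_odd hq hκ hκ' hc j hL
  have s3 : S.L' (2 * j + 3) = _ := L'_odd (j + 1)
  have s2 := L'_even (S := S) j
  have k := comm_of_commute (hL (2 * j + 1) (by omega))
  have s3' : S.L (2 * j + 3) - S.L' (2 * j + 3)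
      = S.l * S.t (2 * j + 2) - S.t (2 * j + 2) * S.l := by
    rw [s3, t, s2]
    linear_combination (norm := skip) (1 / 2 : ℂ) • k
    simp only [show 2 * (j + 1) = 2 * j + 2 by ring,
      Nat.add_assoc, Nat.reduceAdd, mul_add, add_mul, mul_sub, sub_mul, smul_mul_assoc,
      mul_smul_comm, mul_assoc, smul_add, smul_sub]
    module
  have ht' := ht.eq
  generalize S.t (2 * j + 2) = T at *
  simp only [t]
  linear_combination (norm := skip) (1 / 4 : ℂ) • e1 - (1 / 4 : ℂ) • e2
    - (1 / 4 : ℂ) • (S.h * s3' - s3' * S.h) + (1 / 4 : ℂ) • (ht' * S.l - S.l * ht')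
  simp only [mul_add, add_mul, mul_sub, sub_mul, smul_mul_assoc,
    mul_smul_comm, mul_assoc, smul_add, smul_sub]
  module

theorem l_mul_L_sub_L' (n : ℕ) (hL : ∀ m, m + 1 ≤ n → Commute (S.L m) (S.l * S.l)) :
    S.l * (S.L n - S.L' n) = (-1 : ℂ) ^ n • ((S.L n - S.L' n) * S.l) := by
  cases n with
  | zero => simp [L, L']
  | succ n =>
    have e := (hL n le_rfl).eq
    rw [L_sub_L']
    rcases neg_one_pow_eq_or ℂ n with hn | hn <;>
    · simp only [pow_succ, hn, one_smul, neg_smul, mul_neg, mul_one, neg_neg]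
      linear_combination (norm := noncomm_ring) -e

/-! ### Skew derivatives of `y_n` and `L_n`, and the commutation of `L_n` with `l²`. -/

/-- Skew derivations that separate the points of the augmentation ideal. -/
structure SkewDerivations (S : SerrePair q A) where
  D₁ : A →ₗ[ℂ] A
  D₂ : A →ₗ[ℂ] A
  σ₁ : A →ₐ[ℂ] A
  σ₂ : A →ₐ[ℂ] A
  ε : A →ₐ[ℂ] ℂ
  D₁_mul : ∀ a b, D₁ (a * b) = a * D₁ b + D₁ a * σ₁ b
  D₂_mul : ∀ a b, D₂ (a * b) = a * D₂ b + D₂ a * σ₂ b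
  D₁_x₁ : D₁ S.x₁ = 1
  D₁_x₂ : D₁ S.x₂ = 0
  D₂_x₁ : D₂ S.x₁ = 0
  D₂_x₂ : D₂ S.x₂ = 1
  σ₁_x₁ : σ₁ S.x₁ = q • S.x₁
  σ₁_x₂ : σ₁ S.x₂ = q⁻¹ • S.x₂
  σ₂_x₁ : σ₂ S.x₁ = q⁻¹ • S.x₁
  σ₂_x₂ : σ₂ S.x₂ = (-q) • S.x₂
  eq_zero : ∀ a, D₁ a = 0 → D₂ a = 0 → ε a = 0 → a = 0

namespace SkewDerivations

variable (D : SkewDerivations S)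

theorem σ₁_l (hq : q ≠ 0) : D.σ₁ S.l = S.l := by
  simp only [S.l_def, map_sub, map_mul, map_smul, D.σ₁_x₁, D.σ₁_x₂, smul_mul_assoc, mul_smul_comm]
  match_scalars <;> field_simp

theorem σ₂_l (hq : q ≠ 0) : D.σ₂ S.l = -S.l := by
  simp only [S.l_def, map_sub, map_mul, map_smul, D.σ₂_x₁, D.σ₂_x₂, smul_mul_assoc, mul_smul_comm]
  match_scalars <;> field_simp

theorem D₁_l : D.D₁ S.l = 0 := by
  simp [S.l_def, D.D₁_mul, D.D₁_x₁, D.D₁_x₂, D.σ₁_x₂]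

theorem D₂_l (hq : q ≠ 0) : D.D₂ S.l = (q⁻¹ * (q - q⁻¹)) • S.x 0 := by
  simp only [S.l_def, map_sub, map_smul, D.D₂_mul, D.D₂_x₁, D.D₂_x₂, D.σ₂_x₁, x, mul_one, one_mul,
    zero_mul, mul_zero]
  match_scalars
  field_simp

theorem σ₁_y (hq : q ≠ 0) (n : ℕ) : D.σ₁ (S.y n) = q⁻¹ • S.y n := by
  induction n with
  | zero => exact D.σ₁_x₂
  | succ n ih =>
    simp only [y, map_add, map_mul, map_smul, ih, D.σ₁_l hq, mul_smul_comm, smul_mul_assoc]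
    module

theorem σ₂_y (hq : q ≠ 0) (n : ℕ) : D.σ₂ (S.y n) = ((-1) ^ n * -q) • S.y n := by
  induction n with
  | zero => simpa [y] using D.σ₂_x₂
  | succ n ih =>
    simp only [y, map_add, map_mul, map_smul, ih, D.σ₂_l hq, mul_smul_comm, smul_mul_assoc]
    simp only [pow_succ, neg_mul, mul_neg]
    module

theorem D₁_y (n : ℕ) : D.D₁ (S.y n) = 0 := by
  induction n with
  | zero => exact D.D₁_x₂
  | succ n ih => simp [y, D.D₁_mul, ih, D.D₁_l]

theorem D₁_w_zero (hq : q ≠ 0) (n : ℕ) : D.D₁ (S.w 0 n) = 0 := by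
  simp [w, D.D₁_mul, D.D₁_y, D.σ₁_y hq, x, D.D₁_x₁]

/-- The normalization `L'_0 = (q - q⁻¹)⁻¹` is what makes the formula start at `n = 0`. The inductive
step trades `l (L_n - L'_n)` for `± (L_n - L'_n) l`, and there the commutation with `l²` enters. -/
theorem D₂_y (hq : q ≠ 0) (hθ : q - q⁻¹ ≠ 0) (n : ℕ)
    (hL : ∀ m, m + 2 ≤ n → Commute (S.L m) (S.l * S.l)) :
    D.D₂ (S.y n) = ((-1) ^ n * (q - q⁻¹)) • S.L' n := by
  induction n with
  | zero =>
    rw [L', Algebra.algebraMap_eq_smul_one, smul_smul, pow_zero, one_mul, mul_inv_cancel₀ hθ,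
      one_smul]
    exact D.D₂_x₂
  | succ n ih =>
    have key := l_mul_L_sub_L' (S := S) n fun m hm => hL m (by omega)
    have hw : S.x 0 * S.y n = S.L (n + 1) + q⁻¹ • (S.y n * S.x 0) := by
      simpa [L] using S.x_mul_y 0 n
    have h' : S.L' (n + 1) = S.L (n + 1) - (S.l * S.L n - (-1 : ℂ) ^ n • (S.L n * S.l)) := by
      rw [← L_sub_L']
      abel
    rw [y, map_add, map_smul, D.D₂_mul, D.D₂_mul, ih fun m hm => hL m (by omega), D.D₂_l hq,
      D.σ₂_y hq, D.σ₂_l hq, h']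
    simp only [smul_mul_assoc, mul_smul_comm, hw]
    rcases neg_one_pow_eq_or ℂ n with hn | hn <;>
    · simp only [pow_succ, hn, one_smul, neg_smul, mul_sub, sub_mul, smul_sub] at key ⊢
      linear_combination (norm := skip) (-(-1 : ℂ) ^ n * (q - q⁻¹)) • key
      simp only [hn, mul_neg, smul_sub, smul_neg]
      match_scalars <;> field_simp <;> ring

theorem σ₂_L (hq : q ≠ 0) (n : ℕ) : D.σ₂ (S.L n) = (-1 : ℂ) ^ n • S.L n := by
  cases n with
  | zero => simp [L, AlgHom.commutes]
  | succ n =>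
    simp only [L, w, map_sub, map_smul, map_mul, D.σ₂_y hq, x, D.σ₂_x₁, smul_mul_assoc,
      mul_smul_comm, pow_succ]
    match_scalars <;> field_simp

theorem D₂_L (hq : q ≠ 0) (hθ : q - q⁻¹ ≠ 0) (n : ℕ)
    (hL : ∀ m, m + 2 ≤ n → Commute (S.L m) (S.l * S.l)) :
    D.D₂ (S.L (n + 1)) = ((-1) ^ n * (q - q⁻¹)) •
      (S.x 0 * S.L' n - (q⁻¹ * q⁻¹) • (S.L' n * S.x 0)) := by
  simp only [L, w, map_sub, map_smul, D.D₂_mul, D.D₂_y hq hθ n hL, x, D.D₂_x₁, D.σ₂_x₁,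
    smul_mul_assoc, mul_smul_comm, mul_zero, zero_mul, zero_mul, pow_zero]
  module

end SkewDerivations

/-- The commutator is annihilated by `D₁`, which kills both `L_{2j+4}` and `l`, by `D₂` thanks to
`x_one_comm_L`, and by the augmentation, whose target is commutative. -/
theorem SkewDerivations.commute_L_even (D : SkewDerivations S) (hq : q ≠ 0)
    (hθ : q - q⁻¹ ≠ 0) (hκ : q + q⁻¹ - 1 ≠ 0)
    (hκ' : q + q⁻¹ + 1 ≠ 0) (hκ'' : q ^ 2 + 1 ≠ 0) (hc : Commute S.h (S.l * S.l)) (j : ℕ)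
    (hL : ∀ m ≤ 2 * j + 3, Commute (S.L m) (S.l * S.l)) :
    Commute (S.L (2 * j + 4)) (S.l * S.l) := by
  refine sub_eq_zero.1 (D.eq_zero _ ?_ ?_ ?_)
  · have h1 : D.D₁ (S.L (2 * j + 4)) = 0 := D.D₁_w_zero hq _
    simp [D.D₁_mul, h1, D.D₁_l]
  · have e1 := x_one_comm_L hq hκ hκ' hκ'' hc j hL
    have e2 := S.x_comm_c 0
    have e3 := (commute_c_L' hL).eq
    have e4 : S.x 0 * S.l - S.l * S.x 0 = S.x 1 := by simp [x]
    have h2 := D.D₂_L hq hθ (2 * j + 3) fun m hm => hL m (by omega)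
    have p1 : (-1 : ℂ) ^ (2 * j + 3) = -1 := by simp [pow_mul, pow_succ]
    have p2 : (-1 : ℂ) ^ (2 * j + 4) = 1 := by simp [pow_mul, pow_succ]
    have h3 := D.σ₂_L hq (2 * j + 4)
    rw [p1] at h2
    rw [p2, one_smul] at h3
    simp only [map_sub, map_mul, D.D₂_mul, D.D₂_l hq, D.σ₂_l hq, h3,
      show D.D₂ (S.L (2 * j + 4)) = _ from h2]
    generalize S.L (2 * j + 4) = K at *
    generalize S.L' (2 * j + 3) = J at *
    simp only [zero_add] at e2
    rw [← e2, ← e4] at e1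
    linear_combination (norm := skip) (q⁻¹ * (q - q⁻¹)) • e1
      - (q - q⁻¹) • (S.x 0 * e3) + (q⁻¹ * q⁻¹ * (q - q⁻¹)) • (e3 * S.x 0)
    simp only [mul_add, add_mul, mul_sub, sub_mul, smul_mul_assoc, mul_smul_comm, mul_neg, neg_mul,
      neg_neg, mul_assoc, smul_sub]
    match_scalars <;> field_simp <;> ring
  · simp [mul_comm]

/-- In the sum of the even relations only the anticommutator of `l` with `[l, L_{2j+2}]` is left,
and this is `[l², L_{2j+2}] = 0`. -/
theorem commute_h_t_even (hq : q ≠ 0) (hκ : q + q⁻¹ - 1 ≠ 0) (hκ' : q + q⁻¹ + 1 ≠ 0)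
    (hc : Commute S.h (S.l * S.l)) (j : ℕ) (hL : ∀ m ≤ 2 * j + 2, Commute (S.L m) (S.l * S.l)) :
    Commute S.h (S.t (2 * j + 2)) := by
  obtain ⟨e1, e2⟩ := comm_relations_even hq hκ hκ' hc j (hL _ (by omega))
  have c1 := (hL _ le_rfl).eq
  have c2 := (commute_c_L' hL).eq
  have s3 : S.L' (2 * j + 3) = _ := L'_odd (j + 1)
  rw [s3, sub_eq_zero.2 c1] at e1
  rw [s3, sub_eq_zero.2 c2] at e2
  refine sub_eq_zero.1 ?_
  rw [t]
  linear_combination (norm := skip) (1 / 2 : ℂ) • e1 + (1 / 2 : ℂ) • e2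
    + ((q - q⁻¹) / 2) • c1
  simp only [show 2 * (j + 1) = 2 * j + 2 by ring, Nat.add_assoc, Nat.reduceAdd, mul_add, add_mul,
    mul_sub, sub_mul, smul_mul_assoc, mul_smul_comm, mul_assoc, smul_add, smul_sub]
  module

theorem t_three_eq (hq : q ≠ 0) :
    S.t 3 = (1 / 2 * (q - q⁻¹)) • (S.l * S.h) + (1 / 2 * (q - q⁻¹)) • (S.h * S.l) := by
  change (1 / 2 : ℂ) • (S.w 0 2 + S.w 1 1) = _
  rw [w_zero_two_eq S hq, w_one_one_eq S hq]
  module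

/-- Both statements must be proved together: the formula for `t_{2j+5}`, which gives the commutation
of `L_{2j+5}` with `l²`, requires `[h, t_{2j+2}] = 0`, and `[h, t_{2j+4}] = 0` requires that of
`L_{2j+4}`. -/
theorem SkewDerivations.commute_all (D : SkewDerivations S) (hq : q ≠ 0) (hθ : q - q⁻¹ ≠ 0)
    (hκ : q + q⁻¹ - 1 ≠ 0) (hκ' : q + q⁻¹ + 1 ≠ 0) (hκ'' : q ^ 2 + 1 ≠ 0) (j : ℕ) :
    (∀ m ≤ 2 * j + 3, Commute (S.L m) (S.l * S.l)) ∧ ∀ i ≤ j + 1, Commute S.h (S.t (2 * i)) := by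
  have hc := S.commute_h_c hq hκ hκ' hκ''
  have hl : Commute S.l (S.l * S.l) := (Commute.refl _).mul_right (Commute.refl _)
  have h0 : Commute S.h (S.t 0) := by
    rw [t_zero]
    exact (Algebra.commutes _ _).symm
  induction j with
  | zero =>
    constructor
    · intro m hm
      interval_cases m
      · exact Algebra.commutes _ _
      · change Commute (S.w 0 0) _
        rwa [← l_eq_w]
      · change Commute (S.w 0 1) _
        rw [w_zero_one_eq]
        exact hc.add_left (Commute.refl _)
      · change Commute (S.w 0 2) _
        rw [w_zero_two_eq S hq]
        exact ((((hl.mul_left hc).add_left (hc.mul_left hl)).smul_left _).sub_left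
          ((hc.mul_left hl).sub_left (hl.mul_left hc))).smul_left _
    · intro i hi
      interval_cases i
      · exact h0
      · exact Commute.refl _
  | succ j ih =>
    obtain ⟨hL, hh⟩ := ih
    have hL4 := D.commute_L_even hq hθ hκ hκ' hκ'' hc j hL
    have hL' : ∀ m ≤ 2 * (j + 1) + 2, Commute (S.L m) (S.l * S.l) := fun m hm => by
      rcases Nat.lt_or_eq_of_le hm with h | h
      · exact hL m (by omega)
      · rw [h]
        exact hL4
    have ht4 : Commute S.h (S.t (2 * j + 4)) := commute_h_t_even hq hκ hκ' hc (j + 1) hL'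
    have ct : ∀ m ≤ 2 * j + 4, Commute (S.t m) (S.l * S.l) := fun m hm =>
      ((hL' m (by omega)).add_left
        (commute_c_L' fun k hk => hL' k (by omega))).smul_left _
    have ht5 := t_odd_eq hq hκ hκ' hc j hL (hh (j + 1) le_rfl)
    have hM : Commute (S.h * S.l - S.l * S.h) (S.l * S.l) :=
      (hc.mul_left hl).sub_left (hl.mul_left hc)
    have c4 := ct (2 * j + 4) le_rfl
    have c2 := ct (2 * j + 2) (by omega)
    have ct5 : Commute (S.t (2 * j + 5)) (S.l * S.l) := by
      rw [ht5]
      exact (((hl.mul_left c4).smul_left _).add_left ((c4.mul_left hl).smul_left _)).add_left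
        (((c2.mul_left hM).sub_left (hM.mul_left c2)).smul_left _)
    have hL5 : S.L (2 * j + 5) = S.t (2 * j + 5)
        + (1 / 2 : ℂ) • (S.l * S.L (2 * j + 4) - S.L (2 * j + 4) * S.l) := by
      have s5 : S.L' (2 * j + 5) = _ := L'_odd (j + 2)
      rw [t, s5, show 2 * (j + 2) = 2 * j + 4 by ring]
      module
    constructor
    · intro m hm
      rcases Nat.lt_or_eq_of_le hm with h | h
      · exact hL' m (by omega)
      · rw [h, show 2 * (j + 1) + 3 = 2 * j + 5 by ring, hL5]
        exact ct5.add_left (((hl.mul_left hL4).sub_left (hL4.mul_left hl)).smul_left _)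
    · intro i hi
      rcases Nat.lt_or_eq_of_le hi with h | h
      · exact hh i (by omega)
      · rw [h]
        exact ht4

theorem SkewDerivations.t_odd_eq (D : SkewDerivations S) (hq : q ≠ 0) (hθ : q - q⁻¹ ≠ 0)
    (hκ : q + q⁻¹ - 1 ≠ 0) (hκ' : q + q⁻¹ + 1 ≠ 0) (hκ'' : q ^ 2 + 1 ≠ 0) (j : ℕ) :
    S.t (2 * j + 3) = (1 / 2 * (q - q⁻¹)) • (S.l * S.t (2 * j + 2))
      + (1 / 2 * (q - q⁻¹)) • (S.t (2 * j + 2) * S.l)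
      + (1 / 4 : ℂ) • (S.t (2 * j) * (S.h * S.l - S.l * S.h)
        - (S.h * S.l - S.l * S.h) * S.t (2 * j)) := by
  cases j with
  | zero =>
    have h0 := Algebra.commutes (q - q⁻¹)⁻¹ (S.h * S.l - S.l * S.h)
    simp only [mul_zero, zero_add, t_two, t_zero, t_three_eq hq, h0, sub_self, smul_zero, add_zero]
  | succ j =>
    obtain ⟨hL, hh⟩ := D.commute_all hq hθ hκ hκ' hκ'' j
    exact SerrePair.t_odd_eq hq hκ hκ' (S.commute_h_c hq hκ hκ' hκ'') j hL (hh (j + 1) le_rfl)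

/-- Apply the derivation `[h, ·]` to the formula for `t_{2j+3}`: it kills the even `t` and takes `l`
to `M` and `M` to `[h, M]`. -/
theorem SkewDerivations.t_even_comm_l (D : SkewDerivations S) (hq : q ≠ 0) (hθ : q - q⁻¹ ≠ 0)
    (hκ : q + q⁻¹ - 1 ≠ 0) (hκ' : q + q⁻¹ + 1 ≠ 0) (hκ'' : q ^ 2 + 1 ≠ 0) (j : ℕ)
    {M : A} (hM : M = S.h * S.l - S.l * S.h) :
    S.t (2 * j + 4) * S.l - S.l * S.t (2 * j + 4)
      = (1 / 2 * (q - q⁻¹)) • (M * S.t (2 * j + 2)) + (1 / 2 * (q - q⁻¹)) • (S.t (2 * j + 2) * M)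
      + (1 / 4 : ℂ) • (S.t (2 * j) * (S.h * M - M * S.h) - (S.h * M - M * S.h) * S.t (2 * j)) := by
  obtain ⟨hL, hh⟩ := D.commute_all hq hθ hκ hκ' hκ'' j
  have h2 := (hh (j + 1) le_rfl).eq
  have h0 := (hh j (Nat.le_succ _)).eq
  rw [SerrePair.t_even_comm_l hq hκ hκ' (S.commute_h_c hq hκ hκ' hκ'') j hL,
    D.t_odd_eq hq hθ hκ hκ' hκ'' j, ← hM]
  rw [show 2 * (j + 1) = 2 * j + 2 by ring] at h2
  generalize S.t (2 * j + 2) = a at *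
  generalize S.t (2 * j) = b at *
  linear_combination (norm := skip) (-(1 / 2 * (q - q⁻¹))) • (hM * a + a * hM)
    + (1 / 2 * (q - q⁻¹)) • (S.l * h2 + h2 * S.l) + (1 / 4 : ℂ) • (h0 * M - M * h0)
  simp only [mul_add, add_mul, mul_sub, sub_mul, smul_mul_assoc, mul_smul_comm, mul_assoc, smul_add,
    smul_sub]
  module
end SerrePair

namespace BraidedNichols

/-! ### The quantum symmetrizer and skew derivations of `T(V)`. -/

section Symmetrizer

variable {K : Type*} [Field K] {ι : Type*} (Q : Matrix ι ι K)

theorem word_append (u v : List ι) : word (K := K) (u ++ v) = word u * word v := by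
  simp [word, MonoidAlgebra.single_mul_single]

theorem word_nil : word (K := K) ([] : List ι) = 1 := rfl

/-- Linear maps out of `T(V)` from their values on words. -/
noncomputable def ofWords {M : Type*} [AddCommGroup M] [Module K M] (f : List ι → M) :
    TensorAlg K ι →ₗ[K] M :=
  (Finsupp.lsum K fun w : FreeMonoid ι => LinearMap.toSpanSingleton K M (f w.toList)) ∘ₗ
    (MonoidAlgebra.coeffLinearEquiv K).toLinearMap

theorem ofWords_word {M : Type*} [AddCommGroup M] [Module K M] (f : List ι → M) (w : List ι) :
    ofWords (K := K) f (word w) = f w := by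
  simp [ofWords, word, MonoidAlgebra.coeffLinearEquiv]

theorem ofWords_one {M : Type*} [AddCommGroup M] [Module K M] (f : List ι → M) :
    ofWords (K := K) f 1 = f [] :=
  ofWords_word f []

@[elab_as_elim]
theorem tensorAlg_induction {p : TensorAlg K ι → Prop} (a : TensorAlg K ι)
    (word : ∀ w : List ι, p (word w)) (add : ∀ a b, p a → p b → p (a + b))
    (smul : ∀ (c : K) a, p a → p (c • a)) : p a :=
  MonoidAlgebra.induction_on a (fun w => word w.toList) add smul

theorem linearMap_ext_word {M : Type*} [AddCommGroup M] [Module K M]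
    {f g : TensorAlg K ι →ₗ[K] M} (h : ∀ w : List ι, f (word w) = g (word w)) : f = g := by
  refine LinearMap.ext fun a => ?_
  induction a using tensorAlg_induction with
  | word w => exact h w
  | add a b ha hb => rw [map_add, map_add, ha, hb]
  | smul c a ha => rw [map_smul, map_smul, ha]

/-- The quantum symmetrizer as a linear map. -/
noncomputable def symmetrizerₗ : TensorAlg K ι →ₗ[K] TensorAlg K ι := ofWords (symmetrizeWord Q)

/-- The skew derivation of `T(V)` that removes a letter `x_i`, on words. -/
noncomputable def skewWord [DecidableEq ι] (i : ι) : List ι → TensorAlg K ι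
  | [] => 0
  | j :: w => word [j] * skewWord i w + if j = i then (w.map (Q i)).prod • word w else 0

/-- The skew derivation of `T(V)` that removes a letter `x_i`. -/
noncomputable def skewDer [DecidableEq ι] (i : ι) : TensorAlg K ι →ₗ[K] TensorAlg K ι :=
  ofWords (skewWord Q i)

/-- The automorphism of `T(V)` by which the letter `x_i` is braided with an element. -/
noncomputable def twist (i : ι) : TensorAlg K ι →ₐ[K] TensorAlg K ι :=
  MonoidAlgebra.lift K (TensorAlg K ι) (FreeMonoid ι) (FreeMonoid.lift fun j => Q i j • word [j])

/-- The augmentation of `T(V)`. -/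
noncomputable def augment : TensorAlg K ι →ₐ[K] K :=
  MonoidAlgebra.lift K K (FreeMonoid ι) (FreeMonoid.lift fun _ => 0)

theorem word_cons (j : ι) (w : List ι) : word (K := K) (j :: w) = word [j] * word w :=
  word_append [j] w

theorem twist_letter (i j : ι) : twist Q i (word [j]) = Q i j • word [j] := by
  simp [twist, word]

theorem twist_word (i : ι) (w : List ι) : twist Q i (word w) = (w.map (Q i)).prod • word w := by
  induction w with
  | nil => simp [word_nil]
  | cons j w ih =>
    rw [word_cons, map_mul, ih, twist_letter, List.map_cons, List.prod_cons, smul_mul_smul_comm]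

theorem augment_letter (j : ι) : augment (K := K) (word [j]) = 0 := by
  simp [augment, word]

theorem skewDer_letter [DecidableEq ι] (i j : ι) : skewDer Q i (word [j]) = if j = i then 1 else 0 := by
  simp [skewDer, ofWords_word, skewWord, word_nil]

theorem skewDer_cons [DecidableEq ι] (i j : ι) (w : List ι) : skewDer Q i (word (j :: w))
    = word [j] * skewDer Q i (word w) + skewDer Q i (word [j]) * twist Q i (word w) := by
  rw [skewDer_letter, twist_word, skewDer, ofWords_word, ofWords_word, skewWord]
  split_ifs <;> simp

theorem skewDer_mul [DecidableEq ι] (i : ι) (a b : TensorAlg K ι) :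
    skewDer Q i (a * b) = a * skewDer Q i b + skewDer Q i a * twist Q i b := by
  induction a using tensorAlg_induction with
  | word u =>
    induction u generalizing b with
    | nil => simp [word_nil, skewDer, ofWords_one, skewWord]
    | cons j u ih =>
      have hj : ∀ c : TensorAlg K ι, skewDer Q i (word [j] * c)
          = word [j] * skewDer Q i c + skewDer Q i (word [j]) * twist Q i c := by
        intro c
        induction c using tensorAlg_induction with
        | word v => rw [← word_cons, skewDer_cons]
        | add a b h h' =>
          simp only [mul_add, map_add, h, h']
          abel
        | smul c a h => simp only [mul_smul_comm, map_smul, h, smul_add]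
      rw [word_cons, mul_assoc, hj, ih, hj, map_mul, mul_add, add_mul, mul_assoc, mul_assoc,
        mul_assoc, add_assoc]
  | add a b h h' =>
    simp only [add_mul, map_add, h, h']
    abel
  | smul c a h => simp only [smul_mul_assoc, map_smul, h, smul_add]

theorem skewDer_ofFn [DecidableEq ι] (i : ι) {n : ℕ} (f : Fin (n + 1) → ι) :
    skewDer Q i (word (List.ofFn f))
    = ∑ a, if f a = i then (∏ j, if a < a.succAbove j then Q (f a) (f (a.succAbove j)) else 1) •
        word (List.ofFn (f ∘ a.succAbove)) else 0 := by
  induction n with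
  | zero =>
    rw [Fin.sum_univ_succ]
    simp [skewDer_letter, word_nil]
  | succ n ih =>
    have ih' := ih (f ∘ Fin.succ)
    rw [List.ofFn_succ, skewDer_cons, show (fun k => f (Fin.succ k)) = f ∘ Fin.succ from rfl, ih',
      Finset.mul_sum, Fin.sum_univ_succ (n := n + 1), add_comm]
    congr 1
    · rw [skewDer_letter, twist_word]
      by_cases h : f 0 = i
      · simp [h, List.map_ofFn, List.prod_ofFn, Function.comp_def, Fin.prod_univ_succ]
      · simp [h]
    · refine Finset.sum_congr rfl fun a _ => ?_
      by_cases h : f a.succ = i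
      · simp only [Function.comp_apply, h, if_true, mul_smul_comm, ← word_cons]
        congr 1
        · simp [Fin.prod_univ_succ]
        · congr 1
          simp [List.ofFn_succ, Function.comp_def]
      · simp [h]

/-- The quantum symmetrizer on the word with letters `f 0, …, f (n - 1)`. -/
noncomputable def symmetrizeFn {n : ℕ} (f : Fin n → ι) : TensorAlg K ι :=
  ∑ σ : Equiv.Perm (Fin n), (∏ a, ∏ b, if a < b ∧ σ b < σ a then Q (f a) (f b) else 1) •
    word (List.ofFn fun i => f (σ⁻¹ i))

theorem symmetrizeFn_comp_cast {m n : ℕ} (h : m = n) (f : Fin n → ι) :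
    symmetrizeFn Q (f ∘ Fin.cast h) = symmetrizeFn Q f := by
  subst h
  rfl

theorem symmetrizeWord_ofFn {n : ℕ} (f : Fin n → ι) :
    symmetrizeWord Q (List.ofFn f) = symmetrizeFn Q f := by
  rw [← symmetrizeFn_comp_cast Q (List.length_ofFn (f := f)) f]
  change symmetrizeFn Q (List.ofFn f).get = _
  congr 1
  ext i
  simp [Fin.cast]

/-- The permutation that moves `a` to the end and permutes the other indices by `τ`. -/
def moveLast {n : ℕ} (a : Fin (n + 1)) (τ : Equiv.Perm (Fin n)) : Equiv.Perm (Fin (n + 1)) :=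
  (finSuccEquiv' a).trans ((Equiv.optionCongr τ).trans (finSuccEquiv' (Fin.last n)).symm)

@[simp] theorem moveLast_self {n : ℕ} (a : Fin (n + 1)) (τ : Equiv.Perm (Fin n)) :
    moveLast a τ a = Fin.last n := by
  simp [moveLast]

@[simp] theorem moveLast_succAbove {n : ℕ} (a : Fin (n + 1)) (τ : Equiv.Perm (Fin n)) (j : Fin n) :
    moveLast a τ (a.succAbove j) = (τ j).castSucc := by
  simp [moveLast]

theorem moveLast_inv_last {n : ℕ} (a : Fin (n + 1)) (τ : Equiv.Perm (Fin n)) :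
    (moveLast a τ)⁻¹ (Fin.last n) = a := by
  rw [Equiv.Perm.inv_eq_iff_eq, moveLast_self]

theorem moveLast_inv_castSucc {n : ℕ} (a : Fin (n + 1)) (τ : Equiv.Perm (Fin n)) (j : Fin n) :
    (moveLast a τ)⁻¹ j.castSucc = a.succAbove (τ⁻¹ j) := by
  rw [Equiv.Perm.inv_eq_iff_eq, moveLast_succAbove, Equiv.Perm.inv_def, Equiv.apply_symm_apply]

theorem moveLast_bijective (n : ℕ) : Function.Bijective
    fun p : Fin (n + 1) × Equiv.Perm (Fin n) => moveLast p.1 p.2 := by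
  rw [Fintype.bijective_iff_injective_and_card]
  refine ⟨?_, by simp [Fintype.card_perm, Nat.factorial_succ]⟩
  rintro ⟨a, τ⟩ ⟨b, ρ⟩ h
  have h' : moveLast a τ = moveLast b ρ := h
  have hab : a = b := by
    rw [← moveLast_inv_last a τ, h', moveLast_inv_last]
  subst hab
  have : τ = ρ := by
    ext1 j
    have := congrArg (fun σ => σ (a.succAbove j)) h'
    simpa using this
  rw [this]

/-- Sort the permutations by the position `a` that is sent to the end; its inversions are then
exactly the pairs of `a` with a later position. -/
theorem symmetrizeFn_succ {n : ℕ} (f : Fin (n + 1) → ι) : symmetrizeFn Q f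
    = ∑ a, (∏ j, if a < a.succAbove j then Q (f a) (f (a.succAbove j)) else 1) •
        (symmetrizeFn Q (f ∘ a.succAbove) * word [f a]) := by
  rw [symmetrizeFn, ← (moveLast_bijective n).sum_comp, Fintype.sum_prod_type]
  refine Finset.sum_congr rfl fun a _ => ?_
  rw [symmetrizeFn, Finset.sum_mul, Finset.smul_sum]
  refine Finset.sum_congr rfl fun τ _ => ?_
  rw [smul_mul_assoc, ← word_append, smul_smul]
  congr 1
  · have (x : Fin n) : ¬ Fin.last n < (τ x).castSucc := (Fin.le_last _).not_gt
    simp [Fin.prod_univ_succAbove _ a, this]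
  · simp only [List.ofFn_succ', moveLast_inv_last, moveLast_inv_castSucc, List.concat_eq_append,
      Function.comp_apply]

/-- The factors in `symmetrizeFn_succ` are the coefficients with which the skew derivations remove
letters (`skewDer_ofFn`). -/
theorem symmetrizerₗ_eq [Fintype ι] [DecidableEq ι] (a : TensorAlg K ι) :
    symmetrizerₗ Q a = augment a • (1 : TensorAlg K ι)
    + ∑ i, symmetrizerₗ Q (skewDer Q i a) * word [i] := by
  induction a using tensorAlg_induction with
  | word w =>
    rcases w with _ | ⟨j, w⟩
    · simp [symmetrizerₗ, skewDer, ofWords_one, skewWord, symmetrizeWord, word_nil]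
    · have h0 : augment (K := K) (word (j :: w)) = 0 := by
        rw [word_cons, map_mul, augment_letter, zero_mul]
      rw [h0, zero_smul, zero_add]
      obtain ⟨f, hf⟩ : ∃ f : Fin (w.length + 1) → ι, List.ofFn f = j :: w :=
        ⟨(j :: w).get, List.ofFn_get _⟩
      rw [← hf]
      simp only [skewDer_ofFn, map_sum, Finset.sum_mul]
      rw [Finset.sum_comm, symmetrizerₗ, ofWords_word, symmetrizeWord_ofFn, symmetrizeFn_succ]
      refine Finset.sum_congr rfl fun a _ => ?_
      simp only [apply_ite (ofWords (symmetrizeWord Q)), map_zero, map_smul, ofWords_word,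
        symmetrizeWord_ofFn, ite_mul, zero_mul, Finset.sum_ite_eq, Finset.mem_univ, if_true,
        smul_mul_assoc]
  | add a b ha hb =>
    simp only [map_add, ha, hb, add_smul, add_mul, Finset.sum_add_distrib]
    abel
  | smul c a ha =>
    simp only [map_smul, ha, smul_add, Finset.smul_sum, smul_mul_assoc, smul_assoc]

/-- The linear map that removes the last letter of a word if it is `x_i`. -/
noncomputable def stripLast [DecidableEq ι] (i : ι) : TensorAlg K ι →ₗ[K] TensorAlg K ι :=
  ofWords fun w => if w.getLast? = some i then word w.dropLast else 0

theorem stripLast_mul [DecidableEq ι] (i j : ι) (a : TensorAlg K ι) :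
    stripLast i (a * word [j]) = if j = i then a else 0 := by
  induction a using tensorAlg_induction with
  | word w => simp [← word_append, stripLast, ofWords_word]
  | add a b ha hb =>
    rw [add_mul, map_add, ha, hb]
    split_ifs <;> simp
  | smul c a ha =>
    rw [smul_mul_assoc, map_smul, ha]
    split_ifs <;> simp

/-- Words with different last letters are independent, so the sum in `symmetrizerₗ_eq` vanishes only
termwise. -/
theorem symmetrizerₗ_eq_zero_iff [Fintype ι] [DecidableEq ι] {a : TensorAlg K ι} :
    symmetrizerₗ Q a = 0 ↔ augment a = 0 ∧ ∀ i, symmetrizerₗ Q (skewDer Q i a) = 0 := by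
  constructor
  · intro h
    rw [symmetrizerₗ_eq] at h
    have h0 : augment a = 0 := by
      have := congrArg augment h
      simpa [augment_letter] using this
    refine ⟨h0, fun i => ?_⟩
    have := congrArg (stripLast i) h
    simpa [h0, stripLast_mul] using this
  · rintro ⟨h0, h⟩
    rw [symmetrizerₗ_eq]
    simp [h0, h]

end Symmetrizer

/-! ### The kernel of the symmetrizer is an ideal; skew derivations descend to the Nichols algebra.
-/

section Nichols

variable {K : Type*} [Field K] {ι : Type*} (Q : Matrix ι ι K)

/-- The span of the words of length less than `n`. -/
noncomputable def wordsLT (n : ℕ) : Submodule K (TensorAlg K ι) :=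
  Submodule.span K (word '' {w : List ι | w.length < n})

theorem word_mem_wordsLT {n : ℕ} {w : List ι} (h : w.length < n) :
    word (K := K) w ∈ wordsLT n :=
  Submodule.subset_span ⟨w, h, rfl⟩

theorem wordsLT_zero : wordsLT (K := K) (ι := ι) 0 = ⊥ := by
  simp [wordsLT]

theorem wordsLT_mono {m n : ℕ} (h : m ≤ n) : wordsLT (K := K) (ι := ι) m ≤ wordsLT n :=
  Submodule.span_mono (Set.image_mono fun _ hw => lt_of_lt_of_le hw h)

theorem exists_mem_wordsLT (a : TensorAlg K ι) : ∃ n, a ∈ wordsLT n := by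
  induction a using tensorAlg_induction with
  | word w => exact ⟨_, word_mem_wordsLT w.length.lt_succ_self⟩
  | add a b ha hb =>
    obtain ⟨m, hm⟩ := ha
    obtain ⟨n, hn⟩ := hb
    exact ⟨max m n, add_mem (wordsLT_mono (le_max_left _ _) hm)
      (wordsLT_mono (le_max_right _ _) hn)⟩
  | smul c a ha =>
    obtain ⟨m, hm⟩ := ha
    exact ⟨m, Submodule.smul_mem _ _ hm⟩

theorem twist_mem_wordsLT (i : ι) {n : ℕ} {a : TensorAlg K ι} (ha : a ∈ wordsLT n) :
    twist Q i a ∈ wordsLT n := by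
  suffices wordsLT n ≤ (wordsLT n).comap (twist Q i).toLinearMap from this ha
  refine Submodule.span_le.2 ?_
  rintro _ ⟨w, hw, rfl⟩
  change twist Q i (word w) ∈ wordsLT n
  rw [twist_word]
  exact Submodule.smul_mem _ _ (word_mem_wordsLT hw)

theorem skewDer_mem_wordsLT [DecidableEq ι] (i : ι) {n : ℕ} {a : TensorAlg K ι}
    (ha : a ∈ wordsLT (n + 1)) : skewDer Q i a ∈ wordsLT n := by
  suffices wordsLT (n + 1) ≤ (wordsLT n).comap (skewDer Q i) from this ha
  refine Submodule.span_le.2 ?_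
  rintro _ ⟨w, hw, rfl⟩
  change skewDer Q i (word w) ∈ wordsLT n
  rcases w with _ | ⟨j, w⟩
  · simp [skewDer, ofWords_one, word_nil, skewWord]
  · rw [← List.ofFn_get (j :: w)]
    have hw' : w.length < n := Nat.lt_of_succ_lt_succ hw
    refine (skewDer_ofFn Q i (n := w.length) _).symm ▸ Submodule.sum_mem _ fun a _ => ?_
    split_ifs
    · exact Submodule.smul_mem _ _ (word_mem_wordsLT (by simpa using hw'))
    · exact zero_mem _

theorem skewDer_one [DecidableEq ι] (i : ι) : skewDer Q i 1 = 0 := by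
  simp [skewDer, ofWords_one, skewWord]

theorem skewDer_twist [DecidableEq ι] (i j : ι) (a : TensorAlg K ι) :
    skewDer Q j (twist Q i a) = Q i j • twist Q i (skewDer Q j a) := by
  have hl (k : ι) : skewDer Q j (twist Q i (word [k]))
      = Q i j • twist Q i (skewDer Q j (word [k])) := by
    rw [twist_letter, map_smul, skewDer_letter]
    split_ifs with h
    · rw [h, map_one]
    · simp
  have hc (k : ι) (b : TensorAlg K ι) : twist Q i (twist Q k b) = twist Q k (twist Q i b) := by
    induction b using tensorAlg_induction with
    | word w => simp only [twist_word, map_smul, smul_smul, mul_comm]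
    | add a b ha hb => simp only [map_add, ha, hb]
    | smul c a ha => simp only [map_smul, ha]
  induction a using tensorAlg_induction with
  | word w =>
    induction w with
    | nil => simp [word_nil, skewDer_one]
    | cons k w ih =>
      rw [word_cons, map_mul, skewDer_mul, ih, hl, skewDer_mul, map_add, map_mul, map_mul, smul_add,
        hc j, twist_letter, smul_mul_assoc, smul_mul_assoc, mul_smul_comm, smul_comm (Q i k),
        smul_mul_assoc]
  | add a b ha hb => simp only [map_add, ha, hb, smul_add]
  | smul c a ha => simp only [map_smul, ha, smul_comm c]

theorem toNichols_surjective : Function.Surjective (toNichols Q) :=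
  RingQuot.mkAlgHom_surjective K _

variable [Fintype ι] [DecidableEq ι]

theorem symmetrizerₗ_twist (i : ι) {a : TensorAlg K ι} (ha : symmetrizerₗ Q a = 0) :
    symmetrizerₗ Q (twist Q i a) = 0 := by
  obtain ⟨n, hn⟩ := exists_mem_wordsLT a
  induction n generalizing a with
  | zero =>
    rw [wordsLT_zero, Submodule.mem_bot] at hn
    simp [hn]
  | succ n ih =>
    rw [symmetrizerₗ_eq_zero_iff] at ha ⊢
    refine ⟨?_, fun j => ?_⟩
    · have : (augment (K := K)).comp (twist Q i) = augment (K := K) := by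
        refine AlgHom.toLinearMap_injective (linearMap_ext_word fun w => ?_)
        change augment (twist Q i (word w)) = augment (word w)
        rw [twist_word, map_smul]
        rcases w with _ | ⟨k, w⟩
        · simp
        · rw [word_cons, map_mul, augment_letter, zero_mul, smul_zero]
      rw [← ha.1]
      exact DFunLike.congr_fun this a
    · rw [skewDer_twist, map_smul, ih (ha.2 j) (skewDer_mem_wordsLT Q j hn), smul_zero]

/-- Induction on the sum of the length bounds: by the skew Leibniz rule each derivative of `a * b`
is a sum of two products with smaller total bound, each again with a factor in the kernel. -/
theorem symmetrizerₗ_mul {a b : TensorAlg K ι} (h : symmetrizerₗ Q a = 0 ∨ symmetrizerₗ Q b = 0) :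
    symmetrizerₗ Q (a * b) = 0 := by
  obtain ⟨k, hk⟩ := exists_mem_wordsLT a
  obtain ⟨m, hm⟩ := exists_mem_wordsLT b
  obtain ⟨n, hn⟩ : ∃ n, n = k + m := ⟨_, rfl⟩
  induction n generalizing a b k m with
  | zero =>
    obtain rfl : k = 0 := by omega
    rw [wordsLT_zero, Submodule.mem_bot] at hk
    simp [hk]
  | succ n ih =>
    rcases k with _ | k
    · rw [wordsLT_zero, Submodule.mem_bot] at hk
      simp [hk]
    rcases m with _ | m
    · rw [wordsLT_zero, Submodule.mem_bot] at hm
      simp [hm]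
    rw [symmetrizerₗ_eq_zero_iff]
    refine ⟨?_, fun i => ?_⟩
    · rcases h with h | h <;> rw [symmetrizerₗ_eq_zero_iff] at h <;> simp [h.1]
    · rw [skewDer_mul, map_add,
        ih (h.imp_right fun h => ((symmetrizerₗ_eq_zero_iff Q).1 h).2 i) (k + 1) hk m
          (skewDer_mem_wordsLT Q i hm) (by omega),
        ih (h.imp (fun h => ((symmetrizerₗ_eq_zero_iff Q).1 h).2 i) (symmetrizerₗ_twist Q i)) k
          (skewDer_mem_wordsLT Q i hk) (m + 1) (twist_mem_wordsLT Q i hm) (by omega), add_zero]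

/-- The quotient is by the ideal generated by the kernel; the kernel being an ideal already, nothing
more is killed. -/
theorem toNichols_eq_zero_iff {a : TensorAlg K ι} : toNichols Q a = 0 ↔ symmetrizerₗ Q a = 0 := by
  constructor
  · intro h
    let I : TwoSidedIdeal (TensorAlg K ι) := TwoSidedIdeal.mk' {a | symmetrizerₗ Q a = 0}
      (map_zero _) (fun {a b} ha hb => by
        rw [Set.mem_ofPred_eq] at *
        rw [map_add, ha, hb, add_zero])
      (fun {a} ha => by
        rw [Set.mem_ofPred_eq] at *
        rw [map_neg, ha, neg_zero])
      (fun {a b} hb => symmetrizerₗ_mul Q (Or.inr hb))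
      (fun {a b} ha => symmetrizerₗ_mul Q (Or.inl ha))
    have hI (b : TensorAlg K ι) : b ∈ I ↔ symmetrizerₗ Q b = 0 := by
      simp [I, TwoSidedIdeal.mem_mk']
    let f : NicholsAlgebra Q →+* I.ringCon.Quotient := RingQuot.lift ⟨I.ringCon.mk', by
      rintro b c ⟨hb, rfl⟩
      rw [map_zero]
      exact (RingCon.eq _).2 ((I.mem_iff b).1 ((hI b).2 hb))⟩
    have hf : I.ringCon.mk' a = I.ringCon.mk' 0 := by
      have : f (toNichols Q a) = I.ringCon.mk' a := by
        rw [show toNichols Q a = RingQuot.mkRingHom (NicholsRel Q) a from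
          DFunLike.congr_fun (RingQuot.mkAlgHom_coe K (NicholsRel Q)) a]
        exact RingQuot.lift_mkRingHom_apply _ _ _
      rw [← this, h, map_zero, map_zero]
    exact (hI a).1 ((I.mem_iff a).2 ((RingCon.eq _).1 hf))
  · intro h
    rw [← map_zero (toNichols Q)]
    exact RingQuot.mkAlgHom_rel K ⟨h, rfl⟩

theorem toNichols_eq_iff {a b : TensorAlg K ι} :
    toNichols Q a = toNichols Q b ↔ symmetrizerₗ Q (a - b) = 0 := by
  rw [← toNichols_eq_zero_iff, map_sub, sub_eq_zero]

theorem exists_nicholsDer (i : ι) : ∃ D : NicholsAlgebra Q →ₗ[K] NicholsAlgebra Q,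
    ∀ a, D (toNichols Q a) = toNichols Q (skewDer Q i a) := by
  -- A linear section of the projection; the choice is irrelevant because the skew derivation
  -- preserves the kernel.
  obtain ⟨s, hs⟩ := (toNichols Q).toLinearMap.exists_rightInverse_of_surjective
    (LinearMap.range_eq_top.2 (toNichols_surjective Q))
  refine ⟨(toNichols Q).toLinearMap ∘ₗ skewDer Q i ∘ₗ s, fun a => ?_⟩
  have h : toNichols Q (s (toNichols Q a)) = toNichols Q a :=
    LinearMap.congr_fun hs (toNichols Q a)
  rw [toNichols_eq_iff, symmetrizerₗ_eq_zero_iff] at h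
  change toNichols Q (skewDer Q i (s (toNichols Q a))) = _
  rw [toNichols_eq_iff, ← map_sub]
  exact h.2 i

theorem exists_nicholsTwist (i : ι) : ∃ σ : NicholsAlgebra Q →ₐ[K] NicholsAlgebra Q,
    ∀ a, σ (toNichols Q a) = toNichols Q (twist Q i a) := by
  refine ⟨RingQuot.liftAlgHom K ⟨(toNichols Q).comp (twist Q i), ?_⟩,
    fun a => RingQuot.liftAlgHom_mkAlgHom_apply ..⟩
  rintro b c ⟨hb, rfl⟩
  rw [map_zero]
  exact (toNichols_eq_zero_iff Q).2 (symmetrizerₗ_twist Q i hb)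

theorem exists_nicholsAugment : ∃ ε : NicholsAlgebra Q →ₐ[K] K,
    ∀ a, ε (toNichols Q a) = augment a := by
  refine ⟨RingQuot.liftAlgHom K ⟨augment, ?_⟩, fun a => RingQuot.liftAlgHom_mkAlgHom_apply ..⟩
  rintro b c ⟨hb, rfl⟩
  rw [map_zero]
  exact ((symmetrizerₗ_eq_zero_iff Q).1 hb).1

/-- The skew derivation of the Nichols algebra that removes a letter `x_i`. -/
noncomputable def nicholsDer (i : ι) : NicholsAlgebra Q →ₗ[K] NicholsAlgebra Q :=
  (exists_nicholsDer Q i).choose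

theorem nicholsDer_toNichols (i : ι) (a : TensorAlg K ι) :
    nicholsDer Q i (toNichols Q a) = toNichols Q (skewDer Q i a) :=
  (exists_nicholsDer Q i).choose_spec a

/-- The automorphism of the Nichols algebra by which `x_i` is braided with an element. -/
noncomputable def nicholsTwist (i : ι) : NicholsAlgebra Q →ₐ[K] NicholsAlgebra Q :=
  (exists_nicholsTwist Q i).choose

theorem nicholsTwist_toNichols (i : ι) (a : TensorAlg K ι) :
    nicholsTwist Q i (toNichols Q a) = toNichols Q (twist Q i a) :=
  (exists_nicholsTwist Q i).choose_spec a

/-- The augmentation of the Nichols algebra. -/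
noncomputable def nicholsAugment : NicholsAlgebra Q →ₐ[K] K := (exists_nicholsAugment Q).choose

theorem nicholsAugment_toNichols (a : TensorAlg K ι) :
    nicholsAugment Q (toNichols Q a) = augment a :=
  (exists_nicholsAugment Q).choose_spec a

/-- The generator `x_i` of the Nichols algebra. -/
noncomputable def gen (i : ι) : NicholsAlgebra Q := toNichols Q (word [i])

theorem nicholsDer_gen (i j : ι) : nicholsDer Q i (gen Q j) = if j = i then 1 else 0 := by
  rw [gen, nicholsDer_toNichols, skewDer_letter]
  split_ifs <;> simp

theorem nicholsTwist_gen (i j : ι) : nicholsTwist Q i (gen Q j) = Q i j • gen Q j := by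
  rw [gen, nicholsTwist_toNichols, twist_letter, map_smul]

theorem nicholsAugment_gen (j : ι) : nicholsAugment Q (gen Q j) = 0 := by
  rw [gen, nicholsAugment_toNichols, augment_letter]

theorem nicholsDer_mul (i : ι) (a b : NicholsAlgebra Q) : nicholsDer Q i (a * b)
    = a * nicholsDer Q i b + nicholsDer Q i a * nicholsTwist Q i b := by
  obtain ⟨a, rfl⟩ := toNichols_surjective Q a
  obtain ⟨b, rfl⟩ := toNichols_surjective Q b
  rw [← map_mul, nicholsDer_toNichols, skewDer_mul]
  simp only [nicholsDer_toNichols, nicholsTwist_toNichols, map_add, map_mul]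

theorem nichols_eq_zero {a : NicholsAlgebra Q} (h : ∀ i, nicholsDer Q i a = 0)
    (h0 : nicholsAugment Q a = 0) : a = 0 := by
  obtain ⟨a, rfl⟩ := toNichols_surjective Q a
  rw [toNichols_eq_zero_iff, symmetrizerₗ_eq_zero_iff]
  refine ⟨by rwa [← nicholsAugment_toNichols Q], fun i => ?_⟩
  rw [← toNichols_eq_zero_iff, ← nicholsDer_toNichols]
  exact h i

end Nichols

/-! ### The Serre relations and skew derivations in `B(𝕍)`. -/

section Special

variable {q : ℂ}

theorem braidingMatrix_zero_zero : braidingMatrix q 0 0 = q := rfl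
theorem braidingMatrix_zero_one : braidingMatrix q 0 1 = q⁻¹ := rfl
theorem braidingMatrix_one_zero : braidingMatrix q 1 0 = q⁻¹ := rfl
theorem braidingMatrix_one_one : braidingMatrix q 1 1 = -q := rfl

/-- The generators of `B(𝕍)` satisfy the two Serre relations. -/
noncomputable def serrePair (hq : q ≠ 0) : SerrePair q (NicholsAlgebra (braidingMatrix q)) where
  x₁ := gen _ 0
  x₂ := gen _ 1
  l := gen _ 0 * gen _ 1 - q⁻¹ • (gen _ 1 * gen _ 0)
  l_def := rfl
  serre₁ := by
    -- The difference of the two sides has vanishing skew derivatives and augmentation.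
    refine sub_eq_zero.1 (nichols_eq_zero _ (fun i => ?_) ?_)
    · fin_cases i <;>
      · simp only [Fin.zero_eta, Fin.mk_one, map_sub, map_mul, map_smul, nicholsDer_mul,
          nicholsDer_gen, nicholsTwist_gen, braidingMatrix_zero_zero, braidingMatrix_zero_one,
          braidingMatrix_one_zero, braidingMatrix_one_one, if_true, one_ne_zero, zero_ne_one,
          if_false, mul_zero, zero_mul, mul_one, one_mul, add_zero, zero_add, smul_zero, mul_add,
          mul_sub, sub_mul, smul_mul_assoc, mul_smul_comm, mul_assoc, smul_add, smul_sub]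
        match_scalars <;> field_simp <;> ring
    · simp only [map_sub, map_mul, map_smul, nicholsAugment_gen, mul_zero, sub_zero, smul_zero]
  serre₂ := by
    refine sub_eq_zero.1 (nichols_eq_zero _ (fun i => ?_) ?_)
    · fin_cases i <;>
      · simp only [Fin.zero_eta, Fin.mk_one, map_sub, map_mul, map_smul, map_add, nicholsDer_mul,
          nicholsDer_gen, nicholsTwist_gen, braidingMatrix_zero_zero, braidingMatrix_zero_one,
          braidingMatrix_one_zero, braidingMatrix_one_one, if_true, one_ne_zero, zero_ne_one,
          if_false, mul_zero, zero_mul, mul_one, one_mul, add_zero, zero_add, smul_zero, mul_add,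
          add_mul, mul_sub, sub_mul, smul_mul_assoc, mul_smul_comm, mul_assoc, smul_add, smul_sub]
        match_scalars <;> field_simp <;> ring
    · simp only [map_sub, map_mul, map_add, map_smul, nicholsAugment_gen, mul_zero, sub_zero,
        smul_zero, add_zero]

/-- The skew derivations of `B(𝕍)` that remove the letters `x_1` and `x_2`. -/
noncomputable def skewDerivations (hq : q ≠ 0) : SerrePair.SkewDerivations (serrePair hq) where
  D₁ := nicholsDer _ 0
  D₂ := nicholsDer _ 1
  σ₁ := nicholsTwist _ 0
  σ₂ := nicholsTwist _ 1
  ε := nicholsAugment _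
  D₁_mul := nicholsDer_mul _ 0
  D₂_mul := nicholsDer_mul _ 1
  D₁_x₁ := nicholsDer_gen _ 0 0
  D₁_x₂ := nicholsDer_gen _ 0 1
  D₂_x₁ := nicholsDer_gen _ 1 0
  D₂_x₂ := nicholsDer_gen _ 1 1
  σ₁_x₁ := nicholsTwist_gen _ 0 0
  σ₁_x₂ := nicholsTwist_gen _ 0 1
  σ₂_x₁ := nicholsTwist_gen _ 1 0
  σ₂_x₂ := nicholsTwist_gen _ 1 1
  eq_zero := fun _ h₁ h₂ h => nichols_eq_zero _ (Fin.forall_fin_two.2 ⟨h₁, h₂⟩) h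

end Special

/-! ### Multidegrees, braided brackets and Shirshov decompositions. -/

section Homogeneous

variable {K : Type*} [Field K] {ι : Type*} [LinearOrder ι] (Q : Matrix ι ι K)

/-- The component of multidegree `α` of `T(V)`. -/
noncomputable def homogeneous (K : Type*) [Field K] (α : ι → ℕ) : Submodule K (TensorAlg K ι) :=
  Submodule.span K (word '' {w : List ι | deg (FreeMonoid.ofList w) = α})

theorem word_mem_homogeneous (w : List ι) :
    word w ∈ homogeneous K (deg (FreeMonoid.ofList w)) :=
  Submodule.subset_span ⟨w, rfl, rfl⟩

theorem deg_append (u v : List ι) : deg (FreeMonoid.ofList (u ++ v))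
    = deg (FreeMonoid.ofList u) + deg (FreeMonoid.ofList v) := by
  ext i
  simp [deg]

theorem mul_mem_homogeneous {α β : ι → ℕ} {a b : TensorAlg K ι} (ha : a ∈ homogeneous K α)
    (hb : b ∈ homogeneous K β) : a * b ∈ homogeneous K (α + β) := by
  have h := Submodule.mul_mem_mul ha hb
  rw [homogeneous, homogeneous, Submodule.span_mul_span] at h
  refine Submodule.span_mono ?_ h
  rintro _ ⟨_, ⟨u, hu, rfl⟩, _, ⟨v, hv, rfl⟩, rfl⟩
  refine ⟨u ++ v, ?_, word_append u v⟩
  rw [Set.mem_ofPred_eq] at *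
  rw [deg_append, hu, hv]

theorem isLyndon_singleton (i : ι) : IsLyndon [i] := by
  refine ⟨by simp, fun u v hu hv h => ?_⟩
  have := congrArg List.length h
  have h1 := List.length_pos_iff.2 hu
  have h2 := List.length_pos_iff.2 hv
  simp at this
  omega

variable [Fintype ι]

theorem mulBraid_eq (a b : TensorAlg K ι) : mulBraid Q a b = ofWords (fun u => ofWords (fun v =>
    chi Q (deg (FreeMonoid.ofList u)) (deg (FreeMonoid.ofList v)) • (word v * word u)) b) a := by
  change a.coeff.sum _ = a.coeff.sum fun u x => x • (b.coeff.sum fun v y =>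
    y • (chi Q (deg u) (deg v) • (word v.toList * word u.toList : TensorAlg K ι)))
  refine Finsupp.sum_congr fun u _ => ?_
  rw [Finsupp.smul_sum]
  refine Finsupp.sum_congr fun v _ => ?_
  simp [word, MonoidAlgebra.single_mul_single, mul_assoc]

theorem mulBraid_of_homogeneous {α β : ι → ℕ} {a b : TensorAlg K ι} (ha : a ∈ homogeneous K α)
    (hb : b ∈ homogeneous K β) : mulBraid Q a b = chi Q α β • (b * a) := by
  rw [mulBraid_eq]
  induction ha using Submodule.span_induction with
  | zero => simp
  | add x y _ _ hx hy => rw [map_add, hx, hy, mul_add, smul_add]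
  | smul c x _ hx => rw [map_smul, hx, mul_smul_comm, smul_comm]
  | mem x hx =>
    obtain ⟨u, rfl, rfl⟩ := hx
    rw [ofWords_word]
    induction hb using Submodule.span_induction with
    | zero => simp
    | add x y _ _ hx hy => rw [map_add, hx, hy, add_mul, smul_add]
    | smul c x _ hx => rw [map_smul, hx, smul_mul_assoc, smul_comm]
    | mem x hx =>
      obtain ⟨v, rfl, rfl⟩ := hx
      rw [ofWords_word]

theorem bracket_of_homogeneous {α β : ι → ℕ} {a b : TensorAlg K ι} (ha : a ∈ homogeneous K α)
    (hb : b ∈ homogeneous K β) : bracket Q a b = a * b - chi Q α β • (b * a) := by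
  rw [bracket, mulBraid_of_homogeneous Q ha hb]

theorem superLetter_append {u v : List ι} (hu : IsLyndon u) (hv : IsLyndon v)
    (hmin : ∀ j, 0 < j → j < u.length → ¬ IsLyndon ((u ++ v).drop j)) :
    superLetter Q (u ++ v) = bracket Q (superLetter Q u) (superLetter Q v) := by
  classical
  have hcut : IsLyndonCut (u ++ v) u.length := by
    refine ⟨List.length_pos_iff.2 hu.1, ?_, ?_, ?_⟩
    · simpa using List.length_pos_iff.2 hv.1
    · simpa using hu
    · simpa using hv
  have hex : ∃ i, IsLyndonCut (u ++ v) i := ⟨_, hcut⟩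
  have hfind : Nat.find hex = u.length := by
    rw [Nat.find_eq_iff]
    exact ⟨hcut, fun j hj h => hmin j h.1 hj h.2.2.2⟩
  rw [superLetter, dif_pos hex]
  have h' : ∀ i, i = u.length → bracket Q (superLetter Q ((u ++ v).take i))
      (superLetter Q ((u ++ v).drop i)) = bracket Q (superLetter Q u) (superLetter Q v) := by
    rintro i rfl
    simp
  exact h' _ (by convert hfind)

theorem superLetter_singleton (i : ι) : superLetter Q [i] = word [i] := by
  rw [superLetter, dif_neg]
  rintro ⟨j, h0, h1, -⟩
  rw [List.length_singleton] at h1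
  omega

end Homogeneous

/-! ### Lyndon words and the recursions for `X_n` and `Y_n`. -/

section Words

/-- The word `(x_1 x_2)^n`. -/
abbrev zeroOne (n : ℕ) : List (Fin 2) := (List.replicate n [0, 1]).flatten

theorem zeroOne_succ (n : ℕ) : zeroOne (n + 1) = 0 :: 1 :: zeroOne n := rfl

theorem zeroOne_succ' (n : ℕ) : zeroOne (n + 1) = zeroOne n ++ [0, 1] := by
  simp [zeroOne, List.replicate_succ']

theorem zeroOne_suffix {n : ℕ} {v : List (Fin 2)} (h : v <:+ zeroOne n) (hv : v ≠ []) :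
    (∃ t, v = 1 :: t) ∨ ∃ t, v = 0 :: 1 :: t := by
  induction n with
  | zero => exact absurd (List.suffix_nil.1 h) hv
  | succ n ih =>
    rw [zeroOne_succ, List.suffix_cons_iff, List.suffix_cons_iff] at h
    rcases h with h | h | h
    · exact Or.inr ⟨_, h⟩
    · exact Or.inl ⟨_, h⟩
    · exact ih h

theorem isLyndon_zero_cons_zeroOne (n : ℕ) : IsLyndon (0 :: zeroOne n) := by
  cases n with
  | zero => exact isLyndon_singleton 0
  | succ n =>
    refine ⟨by simp, fun u v hu hv h => ?_⟩
    have hs : v <:+ zeroOne (n + 1) := by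
      rcases u with _ | ⟨a, u⟩
      · exact absurd rfl hu
      · exact ⟨u, (List.cons.inj h).2.symm⟩
    rcases zeroOne_suffix hs hv with ⟨t, rfl⟩ | ⟨t, rfl⟩ <;>
      simp [zeroOne_succ, List.cons_lt_cons_iff]

theorem zeroOne_one_lt (n : ℕ) : zeroOne (n + 1) ++ [1] < zeroOne n ++ [1] := by
  induction n with
  | zero => decide
  | succ n ih =>
    exact List.cons_lt_cons_iff.2 (Or.inr ⟨rfl, List.cons_lt_cons_iff.2 (Or.inr ⟨rfl, ih⟩)⟩)

theorem le_of_suffix_zeroOne_one {n : ℕ} {v : List (Fin 2)} (h : v <:+ zeroOne n ++ [1])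
    (hv : v ≠ []) : v = zeroOne n ++ [1] ∨ zeroOne n ++ [1] < v := by
  induction n with
  | zero =>
    rcases List.suffix_cons_iff.1 h with h | h
    · exact Or.inl h
    · exact absurd (List.suffix_nil.1 h) hv
  | succ n ih =>
    rw [zeroOne_succ, List.cons_append, List.suffix_cons_iff, List.cons_append,
      List.suffix_cons_iff] at h
    rcases h with h | rfl | h
    · exact Or.inl h
    · right
      simp [zeroOne_succ, List.cons_lt_cons_iff]
    · right
      rcases ih h with rfl | ih
      · exact zeroOne_one_lt n
      · exact (zeroOne_one_lt n).trans ih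

theorem isLyndon_zeroOne_one (n : ℕ) : IsLyndon (zeroOne n ++ [1]) := by
  refine ⟨by simp, fun u v hu hv h => ?_⟩
  rcases le_of_suffix_zeroOne_one ⟨u, h.symm⟩ hv with h' | h'
  · rw [← h'] at h
    exact absurd (List.self_eq_append_left.1 h) hu
  · exact h'

theorem isLyndon_zero_one : IsLyndon ([0, 1] : List (Fin 2)) := by
  refine ⟨by simp, fun u v hu hv h => ?_⟩
  have hs : v <:+ [1] := by
    rcases u with _ | ⟨a, u⟩
    · exact absurd rfl hu
    · exact ⟨u, (List.cons.inj h).2.symm⟩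
  rcases List.suffix_cons_iff.1 hs with rfl | hs
  · simp [List.cons_lt_cons_iff]
  · exact absurd (List.suffix_nil.1 hs) hv

/-- The proper suffix `(x_1 x_2)^(n+1)` is also a prefix, hence smaller. -/
theorem not_isLyndon_zeroOne (n : ℕ) : ¬ IsLyndon (zeroOne (n + 2)) := by
  have h (n : ℕ) : ¬ zeroOne (n + 1) < zeroOne n := by
    induction n with
    | zero => decide
    | succ n ih =>
      intro H
      have H : 0 :: 1 :: zeroOne (n + 1) < 0 :: 1 :: zeroOne n := H
      rw [List.cons_lt_cons_iff, List.cons_lt_cons_iff] at H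
      simp only [lt_self_iff_false, false_or, true_and] at H
      exact ih H
  exact fun H => h (n + 1) (H.2 [0, 1] (zeroOne (n + 1)) (by simp) (by simp [zeroOne_succ]) rfl)

/-- Suffixes of at least three letters are excluded here, so a cut of `x_1 (x_1 x_2)^(n+1)` inside
the prefix `x_1 (x_1 x_2)^n` leaves no Lyndon word. -/
theorem not_isLyndon_drop_zeroOne {n j : ℕ} (h : j < 2 * n) :
    ¬ IsLyndon ((zeroOne (n + 1)).drop j) := by
  induction n generalizing j with
  | zero => omega
  | succ n ih =>
    rcases j with _ | _ | j
    · exact not_isLyndon_zeroOne n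
    · intro H
      have := H.2 [1] (zeroOne (n + 1)) (by simp) (by simp [zeroOne_succ]) rfl
      simp [zeroOne_succ, List.cons_lt_cons_iff] at this
    · exact ih (by omega)

theorem length_zeroOne (n : ℕ) : (zeroOne n).length = 2 * n := by
  simp [zeroOne, mul_comm]

end Words

section SuperLetters

variable (Q : Matrix (Fin 2) (Fin 2) ℂ)

theorem superLetter_zero_one :
    superLetter Q [0, 1] = bracket Q (word [0]) (word [1]) := by
  rw [← superLetter_singleton Q 0, ← superLetter_singleton Q 1]
  refine superLetter_append Q (u := [0]) (v := [1]) (isLyndon_singleton 0) (isLyndon_singleton 1)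
    fun j h0 h1 => ?_
  rw [List.length_singleton] at h1
  omega

theorem superLetter_zero_cons_zeroOne (n : ℕ) : superLetter Q (0 :: zeroOne (n + 1))
    = bracket Q (superLetter Q (0 :: zeroOne n)) (superLetter Q [0, 1]) := by
  have e : 0 :: zeroOne (n + 1) = (0 :: zeroOne n) ++ [0, 1] := by
    rw [zeroOne_succ', List.cons_append]
  rw [e]
  refine superLetter_append Q (isLyndon_zero_cons_zeroOne n) isLyndon_zero_one fun j h0 h1 => ?_
  rw [← e]
  obtain ⟨j, rfl⟩ := Nat.exists_eq_succ_of_ne_zero h0.ne'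
  rw [List.length_cons, length_zeroOne] at h1
  exact not_isLyndon_drop_zeroOne (by omega)

theorem superLetter_zeroOne_one (n : ℕ) : superLetter Q (zeroOne (n + 1) ++ [1])
    = bracket Q (superLetter Q [0, 1]) (superLetter Q (zeroOne n ++ [1])) := by
  refine superLetter_append Q (u := [0, 1]) (v := zeroOne n ++ [1]) isLyndon_zero_one
    (isLyndon_zeroOne_one n) fun j h0 h1 H => ?_
  obtain rfl : j = 1 := by
    rw [show ([0, 1] : List (Fin 2)).length = 2 from rfl] at h1
    omega
  have := H.2 (1 :: zeroOne n) [1] (by simp) (by simp) rfl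
  simp at this

end SuperLetters

/-! ### Bidegrees and images in `B(𝕍)` of the elements in the theorem. -/

section Images

variable {q : ℂ}

/-- The element `a` of `T(𝕍)` has bidegree `(m, n)` and the image `b` in `B(𝕍)`. -/
def Represents (q : ℂ) (m n : ℕ) (a : TV) (b : NicholsAlgebra (braidingMatrix q)) : Prop :=
  a ∈ homogeneous ℂ ![m, n] ∧ toB q a = b

namespace Represents

variable {m n m' n' : ℕ} {a a' : TV} {b b' : NicholsAlgebra (braidingMatrix q)}

theorem add (h : Represents q m n a b) (h' : Represents q m n a' b') :
    Represents q m n (a + a') (b + b') :=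
  ⟨add_mem h.1 h'.1, by rw [map_add, h.2, h'.2]⟩

theorem smul (c : ℂ) (h : Represents q m n a b) : Represents q m n (c • a) (c • b) :=
  ⟨Submodule.smul_mem _ _ h.1, by rw [map_smul, h.2]⟩

theorem zero (m n : ℕ) : Represents q m n 0 0 := ⟨zero_mem _, map_zero _⟩

theorem mul (h : Represents q m n a b) (h' : Represents q m' n' a' b') :
    Represents q (m + m') (n + n') (a * a') (b * b') :=
  ⟨by simpa using mul_mem_homogeneous h.1 h'.1, by rw [map_mul, h.2, h'.2]⟩

/-- The exponent of `q` is `(m - n)(m' - n')`, so it vanishes if one factor has diagonal bidegree;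
the sign comes from `q_22 = -q` alone. -/
theorem br (h : Represents q m n a b) (h' : Represents q m' n' a' b') (hq : q ≠ 0) {s : ℤ} {k : ℕ}
    (hs : (m * m' + n * n' - m * n' - n * m' : ℤ) = s) (hk : n * n' = k) :
    Represents q (m + m') (n + n') (br q a a') (b * b' - ((-1) ^ k * q ^ s) • (b' * b)) := by
  subst hs hk
  have e : chi (braidingMatrix q) ![m, n] ![m', n']
      = (-1) ^ (n * n') * q ^ (m * m' + n * n' - m * n' - n * m' : ℤ) := by
    have h1 : q ^ (m * m' + n * n' - m * n' - n * m' : ℤ)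
        = q ^ (m * m') * q ^ (n * n') * (q ^ (m * n'))⁻¹ * (q ^ (n * m'))⁻¹ := by
      rw [zpow_sub₀ hq, zpow_sub₀ hq, zpow_add₀ hq, div_eq_mul_inv, div_eq_mul_inv]
      norm_cast
    simp only [chi, Fin.prod_univ_two, braidingMatrix_zero_zero, braidingMatrix_zero_one,
      braidingMatrix_one_zero, braidingMatrix_one_one, Matrix.cons_val_zero, Matrix.cons_val_one,
      inv_pow, h1]
    rw [neg_pow q]
    ring
  rw [← e]
  refine ⟨?_, ?_⟩
  · rw [BraidedNichols.br, bracket_of_homogeneous _ h.1 h'.1]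
    refine sub_mem (by simpa using mul_mem_homogeneous h.1 h'.1) (Submodule.smul_mem _ _ ?_)
    simpa [add_comm] using mul_mem_homogeneous h'.1 h.1
  · rw [BraidedNichols.br, bracket_of_homogeneous _ h.1 h'.1, map_sub, map_smul, map_mul, map_mul,
      h.2, h'.2]

theorem br_of_diag (h : Represents q m m a b) (h' : Represents q n n a' b') (hq : q ≠ 0)
    (hk : Even (m * n)) : Represents q (m + n) (m + n) (BraidedNichols.br q a a')
      (b * b' - b' * b) := by
  have := h.br h' hq (s := 0) (by ring) rfl
  rwa [hk.neg_one_pow, zpow_zero, mul_one, one_smul] at this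

end Represents

theorem represents_word_zero (hq : q ≠ 0) : Represents q 1 0 (word [0]) (serrePair hq).x₁ := by
  refine ⟨?_, rfl⟩
  have h := word_mem_homogeneous (K := ℂ) (ι := Fin 2) [0]
  rwa [show deg (FreeMonoid.ofList ([0] : List (Fin 2))) = ![1, 0] by decide] at h

theorem represents_word_one (hq : q ≠ 0) : Represents q 0 1 (word [1]) (serrePair hq).x₂ := by
  refine ⟨?_, rfl⟩
  have h := word_mem_homogeneous (K := ℂ) (ι := Fin 2) [1]
  rwa [show deg (FreeMonoid.ofList ([1] : List (Fin 2))) = ![0, 1] by decide] at h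

theorem represents_zero_one (hq : q ≠ 0) :
    Represents q 1 1 (superLetter (braidingMatrix q) [0, 1]) (serrePair hq).l := by
  have h := (represents_word_zero hq).br (represents_word_one hq) hq (s := -1) (by simp) rfl
  rw [zpow_neg_one, zero_mul, pow_zero, one_mul] at h
  rw [superLetter_zero_one]
  exact h

theorem represents_X (hq : q ≠ 0) (n : ℕ) :
    Represents q (n + 1) n (X q (n + 1)) ((serrePair hq).x n) := by
  induction n with
  | zero =>
    change Represents q 1 0 (superLetter _ [0]) (serrePair hq).x₁
    rw [superLetter_singleton]
    exact represents_word_zero hq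
  | succ n ih =>
    have h := ih.br (represents_zero_one hq) hq (s := 0) (by push_cast; ring) (mul_one n)
    rw [zpow_zero, mul_one] at h
    change Represents q _ _ (superLetter _ (0 :: zeroOne (n + 1))) _
    rw [superLetter_zero_cons_zeroOne]
    exact h

theorem represents_Y (hq : q ≠ 0) (n : ℕ) :
    Represents q n (n + 1) (Y q (n + 1)) ((serrePair hq).y n) := by
  induction n with
  | zero =>
    change Represents q 0 1 (superLetter _ [1]) (serrePair hq).x₂
    rw [superLetter_singleton]
    exact represents_word_one hq
  | succ n ih =>
    have h := (represents_zero_one hq).br ih hq (s := 0) (by push_cast; ring) (one_mul (n + 1))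
    rw [zpow_zero, mul_one, add_comm 1 n, add_comm 1 (n + 1)] at h
    have e : (serrePair hq).y (n + 1) = (serrePair hq).l * (serrePair hq).y n
        - (-1 : ℂ) ^ (n + 1) • ((serrePair hq).y n * (serrePair hq).l) := by
      rw [SerrePair.y, pow_succ]
      module
    change Represents q _ _ (superLetter _ (zeroOne (n + 1) ++ [1])) _
    rw [superLetter_zeroOne_one, e]
    exact h

theorem represents_br_X_Y (hq : q ≠ 0) (m n : ℕ) : Represents q (m + n + 1) (m + n + 1)
    (br q (X q (m + 1)) (Y q (n + 1))) ((serrePair hq).w m n) := by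
  have h := (represents_X hq m).br (represents_Y hq n) hq (s := -1) (by push_cast; ring) rfl
  rw [zpow_neg_one, show m + 1 + n = m + n + 1 by ring] at h
  exact h

theorem represents_algebraMap (c : ℂ) : Represents q 0 0 (algebraMap ℂ TV c) (algebraMap ℂ _ c) := by
  refine ⟨?_, AlgHom.commutes _ _⟩
  rw [Algebra.algebraMap_eq_smul_one]
  refine Submodule.smul_mem _ _ ?_
  have h := word_mem_homogeneous (K := ℂ) (ι := Fin 2) []
  rwa [show deg (FreeMonoid.ofList ([] : List (Fin 2))) = ![0, 0] by decide] at h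

theorem represents_L (hq : q ≠ 0) (n : ℕ) : Represents q n n (L q n) ((serrePair hq).L n) := by
  rcases n with _ | n
  · exact represents_algebraMap _
  · have h := represents_br_X_Y hq 0 n
    rwa [zero_add] at h

theorem represents_L' (hq : q ≠ 0) (n : ℕ) : Represents q n n (L' q n) ((serrePair hq).L' n) := by
  rcases n with _ | _ | n
  · exact represents_algebraMap _
  · exact represents_L hq 1
  · have h := represents_br_X_Y hq 1 n
    rwa [add_comm 1 n] at h

theorem represents_Ltilde (hq : q ≠ 0) (n : ℕ) :
    Represents q n n (Ltilde q n) ((serrePair hq).t n) :=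
  ((represents_L hq n).add (represents_L' hq n)).smul _

theorem represents_L_one (hq : q ≠ 0) : Represents q 1 1 (L q 1) (serrePair hq).l := by
  have h := represents_L hq 1
  rwa [show (serrePair hq).L 1 = (serrePair hq).l from (serrePair hq).l_eq_w.symm] at h

theorem represents_Ltilde_zero (hq : q ≠ 0) :
    Represents q 0 0 (Ltilde q 0) (algebraMap ℂ _ (theta q)⁻¹) := by
  have h := represents_Ltilde hq 0
  rwa [SerrePair.t_zero] at h

end Images

variable {q : ℂ}

theorem represents_Ltilde_of_eq (hq : q ≠ 0) {z : ℤ} {n : ℕ} (h : z = n) :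
    Represents q n n (Ltilde q z) ((serrePair hq).t n) := by
  subst h
  exact represents_Ltilde hq n

theorem represents_L_two (hq : q ≠ 0) : Represents q 2 2 (L q 2)
    ((serrePair hq).h + (serrePair hq).l * (serrePair hq).l) := by
  have h := represents_L hq 2
  rwa [show (serrePair hq).L 2 = _ from (serrePair hq).w_zero_one_eq] at h

theorem represents_M3 (hq : q ≠ 0) : Represents q 3 3 (M3 q)
    ((serrePair hq).h * (serrePair hq).l - (serrePair hq).l * (serrePair hq).h) := by
  have h := (represents_L_two hq).br_of_diag (represents_L_one hq) hq (by decide)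
  refine ⟨h.1, h.2.trans ?_⟩
  noncomm_ring

/-- Here `L_2 = h + l²`, and the summand `l²` commutes with `h` and `l`, hence with `M_3`. -/
theorem represents_M5 (hq : q ≠ 0)
    (hc : Commute (serrePair hq).h ((serrePair hq).l * (serrePair hq).l))
    {M : NicholsAlgebra (braidingMatrix q)}
    (hM : M = (serrePair hq).h * (serrePair hq).l - (serrePair hq).l * (serrePair hq).h) :
    Represents q 5 5 (M5 q) ((serrePair hq).h * M - M * (serrePair hq).h) := by
  have h := (represents_L_two hq).br_of_diag (represents_M3 hq) hq (by decide)
  refine ⟨h.1, h.2.trans ?_⟩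
  have e := hc.eq
  rw [hM]
  linear_combination (norm := skip) (serrePair hq).l * e - e * (serrePair hq).l
  simp only [mul_add, add_mul, mul_sub, sub_mul, mul_assoc]
  abel

end BraidedNichols

theorem mainTheorem4 (q : ℂ) (hq0 : q ≠ 0) (hq : ∀ n : ℕ, 0 < n → q ^ n ≠ 1) :
    (∀ k : ℕ, toB q (Ltilde q (4 * k + 1)) = toB q
      ((1 / 2 * theta q) • (L q 1 * Ltilde q (4 * k))
        + (1 / 2 * theta q) • (Ltilde q (4 * k) * L q 1)
        + (1 / 4 : ℂ) • br q (Ltilde q (4 * k - 2)) (M3 q))) ∧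
    (∀ k : ℕ, toB q (br q (Ltilde q (4 * k)) (L q 1)) = toB q
      ((1 / 2 * theta q) • (M3 q * Ltilde q (4 * k - 2))
        + (1 / 2 * theta q) • (Ltilde q (4 * k - 2) * M3 q)
        + (1 / 4 : ℂ) • br q (Ltilde q (4 * k - 4)) (M5 q))) ∧
    (∀ k : ℕ, toB q (br q (Ltilde q (4 * k + 2)) (L q 1)) = toB q
      ((1 / 2 * theta q) • (M3 q * Ltilde q (4 * k))
        + (1 / 2 * theta q) • (Ltilde q (4 * k) * M3 q)
        + (1 / 4 : ℂ) • br q (Ltilde q (4 * k - 2)) (M5 q))) ∧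
    (∀ k : ℕ, toB q (Ltilde q (4 * k + 3)) = toB q
      ((1 / 2 * theta q) • (L q 1 * Ltilde q (4 * k + 2))
        + (1 / 2 * theta q) • (Ltilde q (4 * k + 2) * L q 1)
        + (1 / 4 : ℂ) • br q (Ltilde q (4 * k)) (M3 q))) ∧
    (∀ n : ℕ, toB q (br q (Ltilde q n) (L q 1 ^ 2)) = 0 ∧
      toB q (br q (L q n) (L q 1 ^ 2)) = 0) ∧
    (∀ k : ℕ, toB q (br q (Ltilde q 2) (Ltilde q (4 * k))) = 0 ∧
      toB q (br q (Ltilde q 2) (Ltilde q (4 * k + 2))) = 0) := by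
  -- The four scalars can vanish only at roots of unity, with `q^2`, `q^6`, `q^3`, `q^4` equal to
  -- `1` respectively.
  have hθ : q - q⁻¹ ≠ 0 := fun h => hq 2 (by norm_num) (by
    field_simp at h
    linear_combination h)
  have hκ : q + q⁻¹ - 1 ≠ 0 := fun h => hq 6 (by norm_num) (by
    field_simp at h
    linear_combination (q ^ 4 + q ^ 3 - q - 1) * h)
  have hκ' : q + q⁻¹ + 1 ≠ 0 := fun h => hq 3 (by norm_num) (by
    field_simp at h
    linear_combination (q - 1) * h)
  have hκ'' : q ^ 2 + 1 ≠ 0 := fun h => hq 4 (by norm_num) (by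
    linear_combination (q ^ 2 - 1) * h)
  have D := skewDerivations hq0
  have hc := (serrePair hq0).commute_h_c hq0 hκ hκ' hκ''
  have rl := represents_L_one hq0
  have r3 := represents_M3 hq0
  have r5 := represents_M5 hq0 hc rfl
  have r0 := represents_Ltilde_zero hq0
  have hcomm := D.commute_all hq0 hθ hκ hκ' hκ''
  have hLc (n : ℕ) := (hcomm n).1 n (by omega)
  have hht (j : ℕ) := (hcomm j).2 j (Nat.le_succ j)
  have ht2 : Represents q 2 2 (Ltilde q 2) (serrePair hq0).h := represents_Ltilde hq0 2
  -- Covers (d) with `z = 4k` and (a) with `z = 4k - 2`; likewise `even` covers (b) and (c). The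
  -- cases `k = 0` of (a), (b), (c) involve negative indices and are treated separately.
  have odd (z : ℤ) (j : ℕ) (hz : z = (2 * j : ℕ)) : toB q (Ltilde q (z + 3)) = toB q
      ((1 / 2 * theta q) • (L q 1 * Ltilde q (z + 2))
        + (1 / 2 * theta q) • (Ltilde q (z + 2) * L q 1)
        + (1 / 4 : ℂ) • br q (Ltilde q z) (M3 q)) := by
    have h3 := represents_Ltilde_of_eq hq0 (z := z + 3) (n := 2 * j + 3) (by rw [hz]; norm_cast)
    have h2 := represents_Ltilde_of_eq hq0 (z := z + 2) (n := 2 * j + 2) (by rw [hz]; norm_cast)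
    have h0 := represents_Ltilde_of_eq hq0 hz
    have hb := h0.br_of_diag r3 hq0 (by simp [parity_simps])
    rw [h3.2, D.t_odd_eq hq0 hθ hκ hκ' hκ'' j]
    simp only [map_add, map_smul, map_mul, rl.2, h2.2, hb.2, theta]
  have even (z : ℤ) (j : ℕ) (hz : z = (2 * j : ℕ)) :
      toB q (br q (Ltilde q (z + 4)) (L q 1)) = toB q
      ((1 / 2 * theta q) • (M3 q * Ltilde q (z + 2))
        + (1 / 2 * theta q) • (Ltilde q (z + 2) * M3 q)
        + (1 / 4 : ℂ) • br q (Ltilde q z) (M5 q)) := by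
    have h4 := represents_Ltilde_of_eq hq0 (z := z + 4) (n := 2 * j + 4) (by rw [hz]; norm_cast)
    have h2 := represents_Ltilde_of_eq hq0 (z := z + 2) (n := 2 * j + 2) (by rw [hz]; norm_cast)
    have h0 := represents_Ltilde_of_eq hq0 hz
    have hb := h0.br_of_diag r5 hq0 (by simp [parity_simps])
    have hb' := h4.br_of_diag rl hq0 (by simp [parity_simps])
    rw [hb'.2, D.t_even_comm_l hq0 hθ hκ hκ' hκ'' j rfl]
    simp only [map_add, map_smul, map_mul, r3.2, h2.2, hb.2, theta]
  have br_zero (m : ℕ) (a : TV) (b) (ha : Represents q m m a b) : toB q (br q 0 a) = 0 := by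
    rw [((Represents.zero 0 0).br_of_diag ha hq0 (by simp)).2, zero_mul, mul_zero, sub_zero]
  have hneg2 : Ltilde q (0 - 2) = 0 := rfl
  have hneg4 : Ltilde q (0 - 4) = 0 := rfl
  -- For `k = 0` the right sides of (a) and (c) collapse to this, since `L̃_0 = θ⁻¹`.
  have halg (a : NicholsAlgebra (braidingMatrix q)) :
      a = (1 / 2 * theta q) • (a * algebraMap ℂ _ (theta q)⁻¹)
        + (1 / 2 * theta q) • (algebraMap ℂ _ (theta q)⁻¹ * a) := by
    have hθ' : theta q ≠ 0 := hθ
    rw [← Algebra.commutes, ← Algebra.smul_def]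
    match_scalars
    field_simp
    norm_num
  refine ⟨fun k => ?_, fun k => ?_, fun k => ?_, fun k => ?_, fun n => ⟨?_, ?_⟩, fun k => ⟨?_, ?_⟩⟩
  · rcases k with _ | k
    · have h1 := represents_Ltilde_of_eq hq0 (z := 4 * ((0 : ℕ) : ℤ) + 1) (n := 1) rfl
      rw [h1.2, SerrePair.t_one]
      simp only [hneg2, map_add, map_smul, map_mul, rl.2, Nat.cast_zero, mul_zero, r0.2, br_zero _ _ _ r3,
        smul_zero, add_zero]
      exact halg _
    · convert odd (4 * (k + 1 : ℕ) - 2) (2 * k + 1) (by push_cast; ring) using 3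
      · ring_nf
      · ring_nf
  · rcases k with _ | k
    · have hb := r0.br_of_diag rl hq0 (by simp)
      have hb5 := br_zero _ _ _ r5
      simp only [hneg2, hneg4, Nat.cast_zero, mul_zero, zero_mul, smul_zero, add_zero, zero_add,
        map_smul, hb.2, hb5]
      rw [Algebra.commutes, sub_self]
    · convert even (4 * (k + 1 : ℕ) - 4) (2 * k) (by push_cast; ring) using 3
      · ring_nf
      · ring_nf
  · rcases k with _ | k
    · have hb := ht2.br_of_diag rl hq0 (by decide)
      simp only [hneg2, map_add, map_smul, map_mul, Nat.cast_zero, mul_zero, zero_add, r0.2, r3.2,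
        br_zero _ _ _ r5, smul_zero, add_zero, hb.2]
      exact halg _
    · convert even (4 * (k + 1 : ℕ) - 2) (2 * k + 1) (by push_cast; ring) using 3
      · ring_nf
      · ring_nf
  · exact odd (4 * k) (2 * k) (by push_cast; ring)
  · have h := (represents_Ltilde hq0 n).br_of_diag (rl.mul rl) hq0 (by simp)
    rw [pow_two, h.2]
    have hc' := ((hLc n).add_left (SerrePair.commute_c_L' (n := n) fun m _ => hLc m)).smul_left
      (1 / 2 : ℂ)
    exact sub_eq_zero.2 hc'.eq
  · have h := (represents_L hq0 n).br_of_diag (rl.mul rl) hq0 (by simp)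
    rw [pow_two, h.2]
    exact sub_eq_zero.2 (hLc n).eq
  · have h := ht2.br_of_diag (represents_Ltilde_of_eq hq0 (z := 4 * k) (n := 2 * (2 * k))
      (by push_cast; ring)) hq0 (by simp)
    rw [h.2]
    exact sub_eq_zero.2 (hht (2 * k)).eq
  · have h := ht2.br_of_diag (represents_Ltilde_of_eq hq0 (z := 4 * k + 2) (n := 2 * (2 * k + 1))
      (by push_cast; ring)) hq0 (by simp)
    rw [h.2]
    exact sub_eq_zero.2 (hht (2 * k + 1)).eq
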